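/- Let $X$ be a $d$-regular undirected graph ($d\ge 1$; loops and parallel edges allowed) on a finite nonempty vertex set $V$, with normalized adjacency matrix $A_X$, and let $\lambda\ge 0$ be such that all eigenvalues of $A_X$, listed with multiplicity in decreasing order, except the first (the largest one, equal to $1$), have absolute value at most $\lambda$. A labelling $\varphi:V\to\Sigma$ into a finite set $\Sigma$ is unbiased if $\Pr_{x\in V}[\varphi(x)=s]=1/|\Sigma|$ for all $s\in\Sigma$. For $f:\Sigma^n\to\mathbb C$ let $\|f\|_2=(\mathbb E_{s\in\Sigma^n}|f(s)|^2)^{1/2}$ and $$\mathcal E_X(f)=\mathbb E\,f(\varphi(x_1),\dots,\varphi(x_n))-\mathbb E\,f(\varphi(y_1),\dots,\varphi(y_n)),$$ where $x_1,\dots,x_n$ is the random walk on $X$ ($n-1$ steps) from a uniform start vertex and $y_1,\dots,y_n$ are independent uniform vertices. Call $f$ symmetric if it is invariant under all permutations of the $n$ coordinates. For a finite group $G$ and $f:G^n\to\mathbb C$, the level-$k$ component of $f$ is $$f_k(x)=\sum_{\rho}d_\rho\,\mathrm{tr}\big(\rho(x)^*\hat f(\rho)\big),\qquad \hat f(\rho)=\mathbb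 E_{y\in G^n}[f(y)\rho(y)],$$ the sum being over the irreducible unitary representations $\rho=\rho_1\otimes\cdots\otimes\rho_n$ of $G^n$ (up to equivalence) for which exactly $k$ of the irreducible representations $\rho_i$ of $G$ are nontrivial, and $d_\rho$ being the dimension of $\rho$. **Theorem.** (a) Let $G$ be a finite group, $\varphi:V\to G$ an unbiased labelling, $f:G^n\to\mathbb C$ symmetric, and $\tau=16e\lambda|G|$. If $\lambda<1/2$, then $|\mathcal E_X(f_k)|\le\tau^{k/2}\|f\|_2$ for every $k\ge2$. If $\tau<1$, then $|\mathcal E_X(f)|\le2\tau\|f\|_2$. (b) Let $\Sigma$ be a finite set, $\varphi:V\to\Sigma$ an unbiased labelling, $f:\Sigma^n\to\mathbb C$ symmetric, and $\tau=16e\lambda|\Sigma|$. If $\tau<1$, then $|\mathcal E_X(f)|\le2\tau\|f\|_2=32e\lambda|\Sigma|\,\|f\|_2$. -/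

import Mathlib

open scoped BigOperators

noncomputable section



/-- A `d`-regular undirected graph on the vertex set `V`; loops and parallel edges are allowed.
`edges x y` is the number of edges by which a step from `x` leads to `y`
(a simple graph has `edges x y ∈ {0, 1}` and `edges x x = 0`). -/
structure RegularMultigraph (V : Type*) [Fintype V] (d : ℕ) where
  edges : V → V → ℕ
  symm : ∀ x y, edges x y = edges y x
  regular : ∀ x, ∑ y, edges x y = d

namespace RegularMultigraph

variable {V : Type*} [Fintype V] {d : ℕ}

/-- The degree-normalized adjacency matrix `A_X`. -/
def normAdj (X : RegularMultigraph V d) : Matrix V V ℝ :=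
  Matrix.of fun x y => (X.edges x y : ℝ) / d

theorem normAdj_isHermitian (X : RegularMultigraph V d) : X.normAdj.IsHermitian := by
  ext x y
  simp [normAdj, X.symm x y]

open Classical in
/-- `X` is a `(d, lam)`-expander: if `l₀ ≥ l₁ ≥ ⋯ ≥ l_{N-1}` are the eigenvalues of `A_X` with
multiplicity in decreasing order, then all of them except the largest one, `l₀`, have absolute
value at most `lam`; equivalently `max (|l₁|, |l_{N-1}|) ≤ lam`. -/
def IsExpander (X : RegularMultigraph V d) (lam : ℝ) : Prop :=
  ∀ i : Fin (Fintype.card V), (i : ℕ) ≠ 0 → |X.normAdj_isHermitian.eigenvalues₀ i| ≤ lam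

/-- The probability that the random walk on `n` vertices (`n - 1` steps) is `x₁, …, xₙ`: the first
vertex is uniform, and each further step is along a uniformly random edge at the current vertex. -/
def walkProb (X : RegularMultigraph V d) {n : ℕ} (x : Fin n → V) : ℝ :=
  ∏ i : Fin n, if (i : ℕ) = 0 then (Fintype.card V : ℝ)⁻¹
    else X.normAdj (x ⟨(i : ℕ) - 1, lt_of_le_of_lt (Nat.sub_le _ _) i.isLt⟩) (x i)

/-- `𝓔_X(f)`: the expectation of `f(φ(x₁), …, φ(xₙ))` over the random walk on `n` vertices,
minus its expectation over `n` independent uniform vertices. -/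
def walkError (X : RegularMultigraph V d) {S : Type*} (φ : V → S) {n : ℕ}
    (f : (Fin n → S) → ℂ) : ℂ :=
  (∑ x : Fin n → V, (X.walkProb x : ℂ) * f (φ ∘ x)) - 𝔼 x : Fin n → V, f (φ ∘ x)

end RegularMultigraph

open Classical in
/-- A labelling `φ : V → S` is unbiased if it maps the uniform distribution on `V` to the uniform
distribution on `S`. -/
def IsUnbiased {V S : Type*} [Fintype V] [Fintype S] (φ : V → S) : Prop :=
  ∀ s : S, ((Finset.univ.filter fun x => φ x = s).card : ℝ) / (Fintype.card V : ℝ)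
    = ((Fintype.card S : ℝ))⁻¹

/-- Invariance under all permutations of the coordinates. -/
def IsSymmetricFun {S : Type*} {n : ℕ} (f : (Fin n → S) → ℂ) : Prop :=
  ∀ (σ : Equiv.Perm (Fin n)) (x : Fin n → S), f (x ∘ σ) = f x

/-- The norm `‖f‖₂ = (𝔼 |f(x)|²)^{1/2}` for uniformly distributed `x`. -/
def normTwo {S : Type*} [Fintype S] {n : ℕ} (f : (Fin n → S) → ℂ) : ℝ :=
  Real.sqrt (𝔼 x : Fin n → S, ‖f x‖ ^ 2)

/-- The complex representation on `ℂ^m` given by a homomorphism into the unitary group `U_m`. -/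
def unitaryRep {G : Type*} [Group G] {m : ℕ} (r : G →* Matrix.unitaryGroup (Fin m) ℂ) :
    Representation ℂ G (Fin m → ℂ) :=
  (Matrix.toLinAlgEquiv' : Matrix (Fin m) (Fin m) ℂ ≃ₐ[ℂ] _).toAlgHom.toRingHom.toMonoidHom.comp
    ((Matrix.unitaryGroup (Fin m) ℂ).subtype.comp r)

/-- An irreducible unitary (matrix) representation of `G`. -/
structure UnitaryIrrep (G : Type*) [Group G] where
  dim : ℕ
  hom : G →* Matrix.unitaryGroup (Fin dim) ℂ
  irreducible : (unitaryRep hom).IsIrreducible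

/-- Equivalence (isomorphism) of irreducible representations. -/
instance UnitaryIrrep.setoid (G : Type*) [Group G] : Setoid (UnitaryIrrep G) where
  r ρ σ := Nonempty ((unitaryRep ρ.hom).Equiv (unitaryRep σ.hom))
  iseqv :=
    { refl := fun _ => ⟨Representation.Equiv.refl _⟩
      symm := fun ⟨e⟩ => ⟨e.symm⟩
      trans := fun ⟨e⟩ ⟨e'⟩ => ⟨e.trans e'⟩ }

/-- The set `Ĝ` of irreps of `G`, up to equivalence. -/
def Irrep (G : Type*) [Group G] : Type _ := Quotient (UnitaryIrrep.setoid G)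

namespace Irrep

variable {G : Type*} [Group G]

/-- A representative of the class; the quantities used below do not depend on its choice. -/
def rep (ρ : Irrep G) : UnitaryIrrep G := Quotient.out ρ

/-- The dimension `d_ρ`. -/
def dim (ρ : Irrep G) : ℕ := ρ.rep.dim

/-- The matrix `ρ(g)`. -/
def mat (ρ : Irrep G) (g : G) : Matrix (Fin ρ.dim) (Fin ρ.dim) ℂ := (ρ.rep.hom g).1

/-- `ρ` is the trivial irrep. -/
def IsTriv (ρ : Irrep G) : Prop := ∀ g, ρ.mat g = 1

theorem linearIndependent_character [Fintype G] :
    LinearIndependent ℂ fun ρ : Irrep G => (unitaryRep ρ.rep.hom).character := by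
  classical
  have hG : (Nat.card G : ℂ) ≠ 0 := by simp
  have : Invertible (Nat.card G : ℂ) := invertibleOfNonzero hG
  rw [linearIndependent_iff']
  intro s c hc j hj
  have := fun ρ : Irrep G => ρ.rep.irreducible
  have key : ∀ i : Irrep G, (Nat.card G : ℂ)⁻¹ * ∑ g : G, (unitaryRep i.rep.hom).character g *
      (unitaryRep j.rep.hom).character g⁻¹ = if i = j then 1 else 0 := by
    intro i
    rw [Representation.char_orthonormal]
    congr 1
    apply propext
    constructor
    · intro h
      have h2 : Quotient.out j ≈ Quotient.out i := h
      exact (Quotient.out_equiv_out.mp h2).symm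
    · rintro rfl
      exact ⟨Representation.Equiv.refl _⟩
  have h0 : (Nat.card G : ℂ)⁻¹ * ∑ g : G, (∑ i ∈ s, c i • (unitaryRep i.rep.hom).character) g *
      (unitaryRep j.rep.hom).character g⁻¹ = 0 := by
    rw [hc]; simp
  have h1 : (Nat.card G : ℂ)⁻¹ * ∑ g : G, (∑ i ∈ s, c i • (unitaryRep i.rep.hom).character) g *
      (unitaryRep j.rep.hom).character g⁻¹ = ∑ i ∈ s, c i * ((Nat.card G : ℂ)⁻¹ *
        ∑ g : G, (unitaryRep i.rep.hom).character g *
          (unitaryRep j.rep.hom).character g⁻¹) := by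
    simp only [Finset.sum_apply, Pi.smul_apply, smul_eq_mul, Finset.sum_mul, Finset.mul_sum]
    rw [Finset.sum_comm]
    refine Finset.sum_congr rfl fun i _ => Finset.sum_congr rfl fun g _ => by ring
  rw [h1] at h0
  simp_rw [key] at h0
  simpa [hj] using h0

instance [Fintype G] : Finite (Irrep G) := (linearIndependent_character (G := G)).finite

instance [Fintype G] : Fintype (Irrep G) := Fintype.ofFinite _

end Irrep

section Fourier

variable {G : Type*} [Group G] [Fintype G] {n : ℕ}

/-- The matrix `ρ₁(x₁) ⊗ ⋯ ⊗ ρₙ(xₙ)` (iterated Kronecker product) of the irrep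
`ρ₁ ⊗ ⋯ ⊗ ρₙ` of `Gⁿ`. -/
def tensorMat (ρ : Fin n → Irrep G) (x : Fin n → G) :
    Matrix (∀ i, Fin (ρ i).dim) (∀ i, Fin (ρ i).dim) ℂ :=
  Matrix.of fun a b => ∏ i, (ρ i).mat (x i) (a i) (b i)

/-- The Fourier coefficient `𝔼_x [f(x) ρ(x)]` at `ρ = ρ₁ ⊗ ⋯ ⊗ ρₙ`. -/
def groupFourierCoeff (f : (Fin n → G) → ℂ) (ρ : Fin n → Irrep G) :
    Matrix (∀ i, Fin (ρ i).dim) (∀ i, Fin (ρ i).dim) ℂ :=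
  𝔼 x : Fin n → G, f x • tensorMat ρ x

open Classical in
/-- The number of `i` for which `ρᵢ` is nontrivial. -/
def irrepLevel (ρ : Fin n → Irrep G) : ℕ :=
  (Finset.univ.filter fun i => ¬ (ρ i).IsTriv).card

open Classical in
/-- The level-`k` component `f_k(x) = ∑_{|ρ| = k} d_ρ ⟨f̂(ρ), ρ(x)⟩`, where the pairing of `A` and
`B` is the trace of `B* A`. -/
def levelComponent (f : (Fin n → G) → ℂ) (k : ℕ) (x : Fin n → G) : ℂ :=
  ∑ ρ ∈ (Finset.univ : Finset (Fin n → Irrep G)).filter (fun ρ => irrepLevel ρ = k),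
    ((∏ i, (ρ i).dim : ℕ) : ℂ) *
      Matrix.trace ((tensorMat ρ x).conjTranspose * groupFourierCoeff f ρ)

end Fourier

end

/-! Split functions on `S` into constants and functions of mean zero. Tensoring over the coordinates
splits `f` into components indexed by patterns `B : Fin n → Bool`, where `true` marks a mean-zero
coordinate. For `S = G` the level-`k` component is the sum of the components with `k` marked
coordinates (`levelComponent_eq_levelSum`), because the nontrivial irreps together have kernel
`|G|·1[x = y] - 1`. All estimates can therefore be made for a plain alphabet.

The kernel of a component is idempotent, so the error of the component pairs it with the mean of a
walk transform, and Cauchy–Schwarz leaves an `L²` norm to bound. Reading the walk from its end, one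
follows the mean and the fluctuation of that transform. A step of the walk preserves the mean and
shrinks the fluctuation by `lam`; a marked coordinate sends mean to fluctuation and fluctuation to
mean or fluctuation, at cost `√|S|` (`walkTransform_bound`). Starting and finishing in the mean thus
takes at least two marks for each excursion, so level one contributes nothing, and level `k` has at
most `k / 2` excursions.

Summing these bounds over the patterns of level `k` gives about `(32 lam |S|)^(k/2) √(n choose k)`
(`levelSum_walkBound_le`). For symmetric `f` all components of one level have equal energy, so each
carries only a `1 / (n choose k)` share of the level's squared norm, and the binomial factors cancel
(`norm_walkError_levelSum_le`). A second Cauchy–Schwarz, over the levels `k ≥ 2`, and a geometric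
series bound the full error (`norm_walkError_le`). -/

noncomputable section

/-! ### Spectral gap on functions of mean zero. -/

namespace RegularMultigraph

variable {V : Type*} [Fintype V] {d : ℕ}

theorem normAdj_symm (X : RegularMultigraph V d) (x y : V) : X.normAdj x y = X.normAdj y x := by
  simp [normAdj, X.symm x y]

theorem sum_normAdj (hd : 0 < d) (X : RegularMultigraph V d) (x : V) :
    ∑ y, X.normAdj x y = 1 := by
  have hd' : (d : ℝ) ≠ 0 := by positivity
  simp only [normAdj, Matrix.of_apply, ← Finset.sum_div]
  rw [← Nat.cast_sum, X.regular, div_self hd']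

theorem sum_normAdj_mul (hd : 0 < d) (X : RegularMultigraph V d) (w : V → ℝ) :
    ∑ x, ∑ y, X.normAdj x y * w y = ∑ y, w y := by
  rw [Finset.sum_comm]
  refine Finset.sum_congr rfl fun y _ => ?_
  rw [← Finset.sum_mul]
  simp_rw [X.normAdj_symm _ y]
  rw [X.sum_normAdj hd, one_mul]

/-- On functions of mean zero, the normalized adjacency matrix contracts by the spectral bound. -/
theorem sum_sq_normAdj_mul_le (hd : 0 < d) (X : RegularMultigraph V d) {lam : ℝ}
    (hlam1 : lam < 1) (hX : X.IsExpander lam) (w : V → ℝ) (hw : ∑ v, w v = 0) :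
    ∑ x, (∑ y, X.normAdj x y * w y) ^ 2 ≤ lam ^ 2 * ∑ v, w v ^ 2 := by
  classical
  rcases isEmpty_or_nonempty V with hV | hV
  · simp
  let hA := X.normAdj_isHermitian
  let b := hA.eigenvectorBasis
  have hself : ∀ i (u : V → ℝ),
      inner ℝ (b i) (WithLp.toLp 2 (X.normAdj.mulVec u)) =
        hA.eigenvalues i * inner ℝ (b i) (WithLp.toLp 2 u) := by
    intro i u
    have h1 : X.normAdj.mulVec (b i).ofLp = hA.eigenvalues i • (b i).ofLp :=
      hA.mulVec_eigenvectorBasis i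
    have hT : X.normAdj.transpose = X.normAdj := by
      ext x y; exact X.normAdj_symm y x
    simp only [EuclideanSpace.inner_eq_star_dotProduct, star_trivial]
    rw [dotProduct_comm, Matrix.dotProduct_mulVec, ← Matrix.mulVec_transpose, hT, h1,
      smul_dotProduct, smul_eq_mul, dotProduct_comm]
  have hone : X.normAdj.mulVec (fun _ => (1 : ℝ)) = fun _ => 1 := by
    ext x
    simp [Matrix.mulVec, dotProduct, X.sum_normAdj hd]
  let e : Fin (Fintype.card V) ≃ V := Fintype.equivOfCardEq (Fintype.card_fin _)
  -- The expander condition concerns the sorted list `eigenvalues₀`; `e` is the reindexing by which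
  -- `eigenvalues` is defined from it.
  have hev : ∀ i, hA.eigenvalues i = hA.eigenvalues₀ (e.symm i) := fun i => rfl
  let i₀ : V := e ⟨0, Fintype.card_pos⟩
  have hne : ∀ i, i ≠ i₀ → |hA.eigenvalues i| ≤ lam := by
    intro i hi
    rw [hev]
    refine hX _ fun h => hi ?_
    have : e.symm i = ⟨0, Fintype.card_pos⟩ := Fin.ext h
    rw [← e.apply_symm_apply i, this]
  let o : EuclideanSpace ℝ V := WithLp.toLp 2 fun _ => 1
  let W : EuclideanSpace ℝ V := WithLp.toLp 2 w
  -- The constant vector has eigenvalue `1`, and all eigenvalues off `i₀` are below `1` since `lam <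
  -- 1`. So the constants lie on the line of `b i₀`, and a mean-zero `w` has no `b i₀` coefficient;
  -- the value of the top eigenvalue is not needed.
  have horth : ∀ i, i ≠ i₀ → inner ℝ (b i) o = 0 := by
    intro i hi
    have h := hself i fun _ => 1
    rw [hone] at h
    have h2 : hA.eigenvalues i < 1 := (le_abs_self _).trans_lt ((hne i hi).trans_lt hlam1)
    have h3 : (1 - hA.eigenvalues i) * inner ℝ (b i) o = 0 := by
      rw [sub_mul, one_mul, sub_eq_zero]; exact h
    exact (mul_eq_zero.mp h3).resolve_left (by linarith)
  have hoW : inner ℝ o W = 0 := by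
    simp [o, W, EuclideanSpace.inner_eq_star_dotProduct, dotProduct, hw]
  have hz : inner ℝ (b i₀) W = 0 := by
    have h1 := b.sum_inner_mul_inner o W
    have h2 := b.sum_inner_mul_inner o o
    rw [Finset.sum_eq_single i₀ (fun i _ hi => by rw [real_inner_comm, horth i hi, zero_mul])
      (fun h => absurd (Finset.mem_univ _) h)] at h1 h2
    rw [hoW] at h1
    refine (mul_eq_zero.mp h1).resolve_left fun h => ?_
    rw [h, zero_mul] at h2
    have : o = 0 := inner_self_eq_zero.mp h2.symm
    have := congrArg (fun z : EuclideanSpace ℝ V => z i₀) this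
    simp [o] at this
  have hnorm : ∀ u : V → ℝ, ∑ v, u v ^ 2 = ∑ i, inner ℝ (b i) (WithLp.toLp 2 u) ^ 2 := by
    intro u
    rw [b.sum_sq_inner_right, EuclideanSpace.norm_sq_eq]
    simp
  change ∑ x, (X.normAdj.mulVec w x) ^ 2 ≤ _
  rw [hnorm, hnorm w, Finset.mul_sum]
  refine Finset.sum_le_sum fun i _ => ?_
  rw [hself, mul_pow]
  by_cases hi : i = i₀
  · rw [hi, hz]; simp
  · refine mul_le_mul_of_nonneg_right ?_ (sq_nonneg _)
    rw [← sq_abs]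
    exact pow_le_pow_left₀ (abs_nonneg _) (hne i hi) 2

end RegularMultigraph

/-! ### Variance and averages over tuples. -/

section Expect

theorem expect_sq_sub_expect {ι : Type*} [Fintype ι] [Nonempty ι] (h : ι → ℝ) :
    𝔼 i, (h i - 𝔼 j, h j) ^ 2 = 𝔼 i, h i ^ 2 - (𝔼 i, h i) ^ 2 := by
  set m := 𝔼 j, h j with hm
  have : ∀ i, (h i - m) ^ 2 = h i ^ 2 - 2 * m * h i + m ^ 2 := fun i => by ring
  simp_rw [this]
  rw [Finset.expect_add_distrib, Finset.expect_sub_distrib, ← Finset.mul_expect,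
    Fintype.expect_const, ← hm]
  ring

theorem expect_sq_sub_expect_le {ι : Type*} [Fintype ι] [Nonempty ι] (h : ι → ℝ) :
    𝔼 i, (h i - 𝔼 j, h j) ^ 2 ≤ 𝔼 i, h i ^ 2 := by
  rw [expect_sq_sub_expect]
  linarith [sq_nonneg (𝔼 i, h i)]

theorem sq_expect_le {ι : Type*} [Fintype ι] [Nonempty ι] (h : ι → ℝ) :
    (𝔼 i, h i) ^ 2 ≤ 𝔼 i, h i ^ 2 := by
  have h1 := expect_sq_sub_expect h
  have h2 : 0 ≤ 𝔼 i, (h i - 𝔼 j, h j) ^ 2 := Finset.expect_nonneg fun i _ => sq_nonneg _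
  linarith

theorem expect_fin_succ {S M : Type*} [Fintype S] [AddCommMonoid M] [Module ℚ≥0 M] {n : ℕ}
    (F : (Fin (n + 1) → S) → M) :
    𝔼 t, F t = 𝔼 s, 𝔼 t, F (Fin.cons s t) := by
  rw [← Finset.expect_product', Finset.univ_product_univ]
  exact (Fintype.expect_equiv (Fin.consEquiv fun _ => S) _ _ fun _ => rfl).symm

theorem sum_fin_succ {S M : Type*} [Fintype S] [AddCommMonoid M] {n : ℕ}
    (F : (Fin (n + 1) → S) → M) :
    ∑ t, F t = ∑ s, ∑ t, F (Fin.cons s t) := by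
  rw [← Fintype.sum_prod_type']
  exact (Fintype.sum_equiv (Fin.consEquiv fun _ => S) _ _ fun _ => rfl).symm

end Expect

/-! ### The two complementary projections on functions of one coordinate. -/

section Kernel

variable {S : Type*} [Fintype S]

open Classical in
/-- The kernels, with respect to the uniform distribution on `S`, of the averaging projection
(`b = false`) and of the complementary projection onto functions of mean zero (`b = true`). -/
def projKernel (b : Bool) (s t : S) : ℝ :=
  if b then (if s = t then (Fintype.card S : ℝ) else 0) - 1 else 1

theorem projKernel_false (s t : S) : projKernel false s t = 1 := rfl

open Classical in
theorem projKernel_true (s t : S) :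
    projKernel true s t = (if s = t then (Fintype.card S : ℝ) else 0) - 1 := by
  simp [projKernel]

theorem projKernel_comm (b : Bool) (s t : S) : projKernel b s t = projKernel b t s := by
  unfold projKernel
  congr 3
  exact propext eq_comm

open Classical in
theorem sum_projKernel (s t : S) :
    ∑ b, projKernel b s t = if s = t then (Fintype.card S : ℝ) else 0 := by
  rw [Fintype.sum_bool, projKernel_true, projKernel_false]; ring

theorem expect_projKernel_true [Nonempty S] (t : S) : 𝔼 s, projKernel true s t = 0 := by
  classical
  simp_rw [projKernel_true]
  rw [Finset.expect_sub_distrib, Fintype.expect_const, Fintype.expect_eq_sum_div_card]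
  simp

/-- Both operators are orthogonal projections: with a symmetric kernel, this identity is
idempotence. -/
theorem expect_projKernel_mul [Nonempty S] (b : Bool) (t u : S) :
    𝔼 s, projKernel b s t * projKernel b s u = projKernel b t u := by
  classical
  cases b
  · simp [projKernel_false]
  · simp_rw [fun s => projKernel_true s t, sub_mul, one_mul]
    rw [Finset.expect_sub_distrib, expect_projKernel_true, Fintype.expect_eq_sum_div_card]
    simp

theorem expect_projKernel_sq_le [Nonempty S] (t : S) :
    𝔼 s, projKernel true s t ^ 2 ≤ Fintype.card S := by
  simp_rw [sq]
  rw [expect_projKernel_mul, projKernel_true]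
  simp

theorem IsUnbiased.expect_projKernel {V : Type*} [Fintype V] [Nonempty V] {φ : V → S}
    (hφ : IsUnbiased φ) (s : S) : 𝔼 v, projKernel true s (φ v) = 0 := by
  classical
  have : Nonempty S := ⟨s⟩
  have hS : (Fintype.card S : ℝ) ≠ 0 := by simp
  simp_rw [projKernel_true]
  rw [Finset.expect_sub_distrib, Fintype.expect_const, Fintype.expect_eq_sum_div_card,
    ← Finset.sum_filter, Finset.sum_const, nsmul_eq_mul, mul_div_right_comm, sub_eq_zero]
  have := hφ s
  simp_rw [eq_comm (a := s)]
  convert congrArg (· * (Fintype.card S : ℝ)) this using 1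
  rw [inv_mul_cancel₀ hS]

end Kernel

/-! ### Mean and fluctuation along the walk. -/

/-- Upper bounds for the `L²` norms of the mean and of the mean-zero part of the transform of the
walk along the pattern `B`. -/
def walkBound (lam c : ℝ) : (n : ℕ) → (Fin n → Bool) → ℝ × ℝ
  | 0, _ => (1, 0)
  | n + 1, B =>
    let p := walkBound lam c n (Fin.tail B)
    if B 0 then (c * (lam * p.2), c * (p.1 + lam * p.2)) else (p.1, lam * p.2)

theorem walkBound_nonneg {lam c : ℝ} (hlam : 0 ≤ lam) (hc : 0 ≤ c) :
    ∀ (n : ℕ) (B : Fin n → Bool), 0 ≤ (walkBound lam c n B).1 ∧ 0 ≤ (walkBound lam c n B).2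
  | 0, _ => by simp [walkBound]
  | n + 1, B => by
    obtain ⟨h1, h2⟩ := walkBound_nonneg hlam hc n (Fin.tail B)
    simp only [walkBound]
    split_ifs <;> constructor <;> positivity

namespace RegularMultigraph

variable {V : Type*} [Fintype V] {d : ℕ} {S : Type*} [Fintype S]

/-- The expectation of `∏ i, projKernel (B i) (t i) (φ (x i))` over the walk `x` from `v`. -/
def walkTransform (X : RegularMultigraph V d) (φ : V → S) :
    (n : ℕ) → (Fin n → Bool) → (Fin n → S) → V → ℝ
  | 0, _, _, _ => 1
  | n + 1, B, t, v => projKernel (B 0) (t 0) (φ v) *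
      ∑ y, X.normAdj v y * walkTransform X φ n (Fin.tail B) (Fin.tail t) y

theorem expect_normAdj_mul (hd : 0 < d) (X : RegularMultigraph V d) (w : V → ℝ) :
    𝔼 x, ∑ y, X.normAdj x y * w y = 𝔼 y, w y := by
  rw [Fintype.expect_eq_sum_div_card, Fintype.expect_eq_sum_div_card, X.sum_normAdj_mul hd]

variable [Nonempty V]

theorem variance_normAdj_mul_le (hd : 0 < d) (X : RegularMultigraph V d) {lam : ℝ}
    (hlam1 : lam < 1) (hX : X.IsExpander lam) (w : V → ℝ) :
    𝔼 x, (∑ y, X.normAdj x y * w y - 𝔼 z, w z) ^ 2 ≤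
      lam ^ 2 * 𝔼 x, (w x - 𝔼 z, w z) ^ 2 := by
  set m := 𝔼 z, w z with hm
  have h0 : ∑ v, (w v - m) = 0 := by
    rw [Finset.sum_sub_distrib, ← Fintype.card_mul_expect w, ← hm]
    simp
  have h := X.sum_sq_normAdj_mul_le hd hlam1 hX (fun v => w v - m) h0
  have h1 : ∀ x, ∑ y, X.normAdj x y * (w y - m) = ∑ y, X.normAdj x y * w y - m := by
    intro x
    simp_rw [mul_sub]
    rw [Finset.sum_sub_distrib, ← Finset.sum_mul, X.sum_normAdj hd, one_mul]
  simp_rw [h1] at h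
  rw [Fintype.expect_eq_sum_div_card, Fintype.expect_eq_sum_div_card, ← mul_div_assoc]
  gcongr

variable [Nonempty S]

/-- Since the labelling is unbiased, the marked kernel has mean zero over `V`, so the mean of `u`
drops out and only its fluctuation reaches the new mean. -/
theorem expect_sq_expect_projKernel_mul_le {φ : V → S} (hφ : IsUnbiased φ) (u : V → ℝ) :
    𝔼 s, (𝔼 v, projKernel true s (φ v) * u v) ^ 2 ≤
      Fintype.card S * 𝔼 v, (u v - 𝔼 z, u z) ^ 2 := by
  set m := 𝔼 z, u z
  have h1 : ∀ s, 𝔼 v, projKernel true s (φ v) * u v =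
      𝔼 v, projKernel true s (φ v) * (u v - m) := by
    intro s
    simp_rw [mul_sub]
    rw [Finset.expect_sub_distrib, ← Finset.expect_mul, hφ.expect_projKernel]
    simp
  simp_rw [h1]
  calc _ ≤ 𝔼 s, 𝔼 v, (projKernel true s (φ v) * (u v - m)) ^ 2 :=
        Finset.expect_le_expect fun s _ => sq_expect_le _
    _ = 𝔼 v, (𝔼 s, projKernel true s (φ v) ^ 2) * (u v - m) ^ 2 := by
        rw [Finset.expect_comm]
        simp_rw [mul_pow, ← Finset.expect_mul]
    _ ≤ 𝔼 v, Fintype.card S * (u v - m) ^ 2 := by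
        refine Finset.expect_le_expect fun v _ => ?_
        exact mul_le_mul_of_nonneg_right (expect_projKernel_sq_le _) (sq_nonneg _)
    _ = _ := by rw [Finset.mul_expect]

/-- A variance is at most the second moment; averaging over `s` first leaves `|S|` times the second
moment of `u`, which is squared mean plus variance. -/
theorem expect_variance_projKernel_mul_le (φ : V → S) (u : V → ℝ) :
    𝔼 s, 𝔼 v, (projKernel true s (φ v) * u v - 𝔼 z, projKernel true s (φ z) * u z) ^ 2 ≤
      Fintype.card S * ((𝔼 z, u z) ^ 2 + 𝔼 v, (u v - 𝔼 z, u z) ^ 2) := by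
  rw [expect_sq_sub_expect u]
  calc _ ≤ 𝔼 s, 𝔼 v, (projKernel true s (φ v) * u v) ^ 2 :=
        Finset.expect_le_expect fun s _ => expect_sq_sub_expect_le _
    _ = 𝔼 v, (𝔼 s, projKernel true s (φ v) ^ 2) * u v ^ 2 := by
        rw [Finset.expect_comm]
        simp_rw [mul_pow, ← Finset.expect_mul]
    _ ≤ 𝔼 v, Fintype.card S * u v ^ 2 := by
        refine Finset.expect_le_expect fun v _ => ?_
        exact mul_le_mul_of_nonneg_right (expect_projKernel_sq_le _) (sq_nonneg _)
    _ = _ := by rw [add_sub_cancel, Finset.mul_expect]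

theorem walkTransform_bound (hd : 0 < d) (X : RegularMultigraph V d) {lam : ℝ}
    (hlam : 0 ≤ lam) (hlam1 : lam < 1) (hX : X.IsExpander lam) {φ : V → S} (hφ : IsUnbiased φ) :
    ∀ (n : ℕ) (B : Fin n → Bool),
      𝔼 t, (𝔼 v, X.walkTransform φ n B t v) ^ 2 ≤
          (walkBound lam (Real.sqrt (Fintype.card S)) n B).1 ^ 2 ∧
      𝔼 t, 𝔼 v, (X.walkTransform φ n B t v - 𝔼 z, X.walkTransform φ n B t z) ^ 2 ≤
          (walkBound lam (Real.sqrt (Fintype.card S)) n B).2 ^ 2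
  | 0, B => by simp [walkTransform, walkBound]
  | n + 1, B => by
    obtain ⟨h1, h2⟩ := walkTransform_bound hd X hlam hlam1 hX hφ n (Fin.tail B)
    have hnn := walkBound_nonneg hlam (Real.sqrt_nonneg (Fintype.card S : ℝ)) n (Fin.tail B)
    rw [expect_fin_succ, expect_fin_succ]
    simp only [walkTransform, walkBound, Fin.cons_zero, Fin.tail_cons]
    set p := walkBound lam (Real.sqrt (Fintype.card S)) n (Fin.tail B)
    set g := X.walkTransform φ n (Fin.tail B)
    set u : (Fin n → S) → V → ℝ := fun t v => ∑ y, X.normAdj v y * g t y with hu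
    have hmean : ∀ t, 𝔼 v, u t v = 𝔼 v, g t v := fun t => X.expect_normAdj_mul hd (g t)
    have hvar : 𝔼 t, 𝔼 v, (u t v - 𝔼 z, u t z) ^ 2 ≤ lam ^ 2 * p.2 ^ 2 := by
      calc _ ≤ 𝔼 t, lam ^ 2 * 𝔼 v, (g t v - 𝔼 z, g t z) ^ 2 := by
            refine Finset.expect_le_expect fun t _ => ?_
            rw [hmean]
            exact X.variance_normAdj_mul_le hd hlam1 hX (g t)
        _ = lam ^ 2 * 𝔼 t, 𝔼 v, (g t v - 𝔼 z, g t z) ^ 2 := by rw [Finset.mul_expect]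
        _ ≤ _ := by gcongr
    have hsqrt : Real.sqrt (Fintype.card S) ^ 2 = Fintype.card S :=
      Real.sq_sqrt (Nat.cast_nonneg _)
    cases hB : B 0
    · simp only [projKernel_false, one_mul, Fintype.expect_const, Bool.false_eq_true, if_false]
      change 𝔼 t, (𝔼 v, u t v) ^ 2 ≤ _ ∧ 𝔼 t, 𝔼 v, (u t v - 𝔼 z, u t z) ^ 2 ≤ _
      refine ⟨?_, by rw [mul_pow]; exact hvar⟩
      simp_rw [hmean]
      exact h1
    · simp only [if_true]
      change 𝔼 s, 𝔼 t, (𝔼 v, projKernel true s (φ v) * u t v) ^ 2 ≤ _ ∧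
        𝔼 s, 𝔼 t, 𝔼 v, (projKernel true s (φ v) * u t v -
          𝔼 z, projKernel true s (φ z) * u t z) ^ 2 ≤ _
      constructor
      · rw [Finset.expect_comm]
        calc _ ≤ 𝔼 t, Fintype.card S * 𝔼 v, (u t v - 𝔼 z, u t z) ^ 2 :=
              Finset.expect_le_expect fun t _ => expect_sq_expect_projKernel_mul_le hφ (u t)
          _ = Fintype.card S * 𝔼 t, 𝔼 v, (u t v - 𝔼 z, u t z) ^ 2 := by rw [Finset.mul_expect]
          _ ≤ Fintype.card S * (lam ^ 2 * p.2 ^ 2) := by gcongr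
          _ = _ := by rw [mul_pow, mul_pow, hsqrt]
      · rw [Finset.expect_comm]
        calc _ ≤ 𝔼 t, Fintype.card S * ((𝔼 z, u t z) ^ 2 + 𝔼 v, (u t v - 𝔼 z, u t z) ^ 2) :=
              Finset.expect_le_expect fun t _ => expect_variance_projKernel_mul_le φ (u t)
          _ = Fintype.card S * (𝔼 t, (𝔼 z, g t z) ^ 2 + 𝔼 t, 𝔼 v, (u t v - 𝔼 z, u t z) ^ 2) := by
              rw [← Finset.mul_expect, Finset.expect_add_distrib]
              simp_rw [hmean]
          _ ≤ Fintype.card S * (p.1 ^ 2 + lam ^ 2 * p.2 ^ 2) := by gcongr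
          -- Enlarging a sum of squares to the square of a sum makes the recursion for the norms
          -- linear, so that it can later be summed over patterns.
          _ ≤ Fintype.card S * (p.1 + lam * p.2) ^ 2 := by
              gcongr
              nlinarith [mul_nonneg hnn.1 (mul_nonneg hlam hnn.2)]
          _ = _ := by rw [mul_pow, hsqrt]

end RegularMultigraph

/-! ### Binomial sums up to half the level. -/

section Binomial

/-- Double counting: two `b`-subsets have a union of size at most `2 * b ≤ k`, hence lie in a common
`k`-subset. -/
theorem sq_choose_le {n k b : ℕ} (hb : 2 * b ≤ k) (hk : k ≤ n) :
    n.choose b ^ 2 ≤ n.choose k * k.choose b ^ 2 := by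
  classical
  let U : Finset (Fin n) := Finset.univ
  have hU : U.card = n := by simp [U]
  have hsub : U.powersetCard b ×ˢ U.powersetCard b ⊆
      (U.powersetCard k).biUnion fun K => K.powersetCard b ×ˢ K.powersetCard b := by
    rintro ⟨P, Q⟩ hPQ
    simp only [Finset.mem_product, Finset.mem_powersetCard] at hPQ
    have hcard : (P ∪ Q).card ≤ k := by
      have := Finset.card_union_le P Q
      omega
    obtain ⟨K, hK1, hK2, hK3⟩ := Finset.exists_subsuperset_card_eq
      (Finset.union_subset hPQ.1.1 hPQ.2.1) hcard (hU.symm ▸ hk)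
    simp only [Finset.mem_biUnion, Finset.mem_product, Finset.mem_powersetCard]
    exact ⟨K, ⟨hK2, hK3⟩, ⟨Finset.subset_union_left.trans hK1, hPQ.1.2⟩,
      ⟨Finset.subset_union_right.trans hK1, hPQ.2.2⟩⟩
  have h1 := Finset.card_le_card hsub
  rw [Finset.card_product, Finset.card_powersetCard, hU, ← sq] at h1
  refine h1.trans (Finset.card_biUnion_le.trans ?_)
  rw [Finset.sum_congr rfl (g := fun _ => k.choose b ^ 2), Finset.sum_const,
    Finset.card_powersetCard, hU, smul_eq_mul]
  intro K hK
  rw [Finset.card_product, Finset.card_powersetCard, (Finset.mem_powersetCard.mp hK).2, sq]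

/-- The number of subsets of an `n`-element set with at most `k / 2` elements. -/
def halfChoose (n k : ℕ) : ℕ := ∑ b ∈ Finset.range (k / 2 + 1), n.choose b

/-- Pascal's rule summed over `b`. The shift of `k` by two matches the two marks used by an
excursion from the mean and back. -/
theorem halfChoose_succ_add_two (n k : ℕ) :
    halfChoose (n + 1) (k + 2) = halfChoose n (k + 2) + halfChoose n k := by
  have h : (k + 2) / 2 = k / 2 + 1 := by omega
  simp only [halfChoose, h]
  rw [Finset.sum_range_succ', Finset.sum_range_succ' (fun b => n.choose b)]
  simp only [Nat.choose_succ_succ, Finset.sum_add_distrib, Nat.choose_zero_right]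
  ring

theorem halfChoose_mono_right (n : ℕ) : Monotone (halfChoose n) := fun k l h =>
  Finset.sum_le_sum_of_subset (Finset.range_mono (by omega))

theorem halfChoose_mono_left (k : ℕ) : Monotone fun n => halfChoose n k := fun _ _ h =>
  Finset.sum_le_sum fun b _ => Nat.choose_le_choose b h

theorem halfChoose_zero (n : ℕ) : halfChoose n 0 = 1 := by simp [halfChoose]

theorem halfChoose_le {n k : ℕ} (hk : k ≤ n) :
    (halfChoose n k : ℝ) ≤ 2 ^ k * Real.sqrt (n.choose k) := by
  have h : ∀ b ∈ Finset.range (k / 2 + 1),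
      (n.choose b : ℝ) ≤ k.choose b * Real.sqrt (n.choose k) := by
    intro b hb
    rw [Finset.mem_range] at hb
    refine abs_le_of_sq_le_sq' ?_ (by positivity) |>.2
    rw [mul_pow, Real.sq_sqrt (Nat.cast_nonneg _), mul_comm]
    exact_mod_cast sq_choose_le (by omega) hk
  rw [halfChoose, Nat.cast_sum]
  refine (Finset.sum_le_sum h).trans ?_
  rw [← Finset.sum_mul]
  refine mul_le_mul_of_nonneg_right ?_ (Real.sqrt_nonneg _)
  rw [← Nat.cast_sum]
  calc ((∑ b ∈ Finset.range (k / 2 + 1), k.choose b : ℕ) : ℝ)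
      ≤ ((∑ b ∈ Finset.range (k + 1), k.choose b : ℕ) : ℝ) := by
        exact_mod_cast Finset.sum_le_sum_of_subset (Finset.range_mono (by omega))
    _ = 2 ^ k := by rw [Nat.sum_range_choose]; norm_cast

end Binomial

/-! ### Summing the walk bounds over the patterns of a level. -/

section Patterns

/-- The number of coordinates at which a pattern is `true`. -/
def patternLevel {n : ℕ} (B : Fin n → Bool) : ℕ := ∑ i, (B i).toNat

theorem patternLevel_cons {n : ℕ} (b : Bool) (B : Fin n → Bool) :
    patternLevel (Fin.cons b B : Fin (n + 1) → Bool) = b.toNat + patternLevel B := by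
  simp [patternLevel, Fin.sum_univ_succ]

theorem patternLevel_le {n : ℕ} (B : Fin n → Bool) : patternLevel B ≤ n := by
  calc patternLevel B ≤ ∑ _i : Fin n, 1 := Finset.sum_le_sum fun i _ => Bool.toNat_le _
    _ = n := by simp

/-- The sum of `F B` over the patterns `B` of level `k`. -/
def levelSum {M : Type*} [AddCommMonoid M] {n : ℕ} (F : (Fin n → Bool) → M) (k : ℕ) : M :=
  ∑ B with patternLevel B = k, F B

theorem levelSum_zero_left {M : Type*} [AddCommMonoid M] (F : (Fin 0 → Bool) → M) (k : ℕ) :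
    levelSum F k = if k = 0 then F Fin.elim0 else 0 := by
  rw [levelSum, Finset.sum_filter, Fintype.sum_unique]
  simp only [patternLevel, Finset.univ_eq_empty, Finset.sum_empty, eq_comm (a := 0)]
  congr 2

theorem levelSum_succ_zero {M : Type*} [AddCommMonoid M] {n : ℕ}
    (F : (Fin (n + 1) → Bool) → M) :
    levelSum F 0 = levelSum (fun B => F (Fin.cons false B)) 0 := by
  simp only [levelSum, Finset.sum_filter]
  rw [sum_fin_succ, Fintype.sum_bool]
  simp [patternLevel_cons]

theorem levelSum_succ_succ {M : Type*} [AddCommMonoid M] {n : ℕ}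
    (F : (Fin (n + 1) → Bool) → M) (k : ℕ) :
    levelSum F (k + 1) = levelSum (fun B => F (Fin.cons false B)) (k + 1) +
      levelSum (fun B => F (Fin.cons true B)) k := by
  simp only [levelSum, Finset.sum_filter]
  rw [sum_fin_succ, Fintype.sum_bool, add_comm]
  simp [patternLevel_cons, add_comm 1]

theorem levelSum_add {n : ℕ} (F F' : (Fin n → Bool) → ℝ) (k : ℕ) :
    levelSum (fun B => F B + F' B) k = levelSum F k + levelSum F' k :=
  Finset.sum_add_distrib

theorem levelSum_const_mul {n : ℕ} (a : ℝ) (F : (Fin n → Bool) → ℝ) (k : ℕ) :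
    levelSum (fun B => a * F B) k = a * levelSum F k :=
  (Finset.mul_sum _ _ _).symm

/-- Splitting on the first coordinate turns `walkBound` into a linear recursion for the level sums
of the mean and fluctuation bounds. The inductive bounds are shaped so that the mean recursion
becomes `halfChoose_succ_add_two`; the fluctuation sums are indexed by `k + 1` because one mark has
already been spent on leaving the mean. -/
theorem levelSum_walkBound {lam c y : ℝ} (hc : 0 ≤ c) (hy : 0 ≤ y) (hy1 : y ≤ 1)
    (hlam : y ^ 2 = 2 * lam) (n : ℕ) :
    (levelSum (fun B => (walkBound lam c n B).1) 0 = 1) ∧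
    (levelSum (fun B => (walkBound lam c n B).1) 1 = 0) ∧
    (levelSum (fun B => (walkBound lam c n B).2) 0 = 0) ∧
    (∀ k, levelSum (fun B => (walkBound lam c n B).1) k ≤
      (2 * c) ^ k * y ^ k * halfChoose n k) ∧
    (∀ k, levelSum (fun B => (walkBound lam c n B).2) (k + 1) ≤
      2 * (2 * c) ^ (k + 1) * y ^ k * halfChoose n k) := by
  induction n with
  | zero =>
    simp only [levelSum_zero_left, walkBound]
    refine ⟨by simp, by simp, by simp, fun k => ?_, fun k => ?_⟩
    · split_ifs with h
      · subst h; simp [halfChoose]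
      · positivity
    · simp; positivity
  | succ n ih =>
    have hl : 0 ≤ lam := by nlinarith [sq_nonneg y]
    have hl2 : 2 * lam ≤ 1 := by rw [← hlam]; exact pow_le_one₀ hy hy1
    obtain ⟨h1, h2, h3, h4, h5⟩ := ih
    have a0 : levelSum (fun B => (walkBound lam c (n + 1) B).1) 0 = 1 := by
      rw [levelSum_succ_zero]
      simpa [walkBound] using h1
    have aS : ∀ k, levelSum (fun B => (walkBound lam c (n + 1) B).1) (k + 1) =
        levelSum (fun B => (walkBound lam c n B).1) (k + 1) +
          c * lam * levelSum (fun B => (walkBound lam c n B).2) k := by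
      intro k
      rw [levelSum_succ_succ]
      simp only [walkBound, Fin.cons_zero, Fin.tail_cons, if_true, Bool.false_eq_true, if_false,
        ← mul_assoc]
      rw [levelSum_const_mul]
    have b0 : levelSum (fun B => (walkBound lam c (n + 1) B).2) 0 = 0 := by
      rw [levelSum_succ_zero]
      simp only [walkBound, Fin.cons_zero, Fin.tail_cons, Bool.false_eq_true, if_false]
      rw [levelSum_const_mul, h3, mul_zero]
    have bS : ∀ k, levelSum (fun B => (walkBound lam c (n + 1) B).2) (k + 1) =
        lam * levelSum (fun B => (walkBound lam c n B).2) (k + 1) +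
          c * (levelSum (fun B => (walkBound lam c n B).1) k +
            lam * levelSum (fun B => (walkBound lam c n B).2) k) := by
      intro k
      rw [levelSum_succ_succ]
      simp only [walkBound, Fin.cons_zero, Fin.tail_cons, if_true, Bool.false_eq_true, if_false]
      rw [levelSum_const_mul, levelSum_const_mul, levelSum_add, levelSum_const_mul]
    refine ⟨a0, ?_, b0, ?_, ?_⟩
    · rw [aS, h2, h3]; simp
    · rintro (_ | _ | k)
      · rw [a0, halfChoose_zero]; simp
      · rw [aS, h2, h3]; simp; positivity
      · rw [aS, halfChoose_succ_add_two, Nat.cast_add]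
        have e := mul_le_mul_of_nonneg_left (h5 k) (mul_nonneg hc hl)
        -- The choice `y ^ 2 = 2 * lam` makes this term half of what the recursion for `halfChoose`
        -- allows.
        have : c * lam * (2 * (2 * c) ^ (k + 1) * y ^ k * halfChoose n k) =
            1 / 2 * ((2 * c) ^ (k + 2) * y ^ (k + 2) * halfChoose n k) := by
          rw [pow_add y k 2, hlam]; ring
        have h0 : 0 ≤ (2 * c) ^ (k + 2) * y ^ (k + 2) * halfChoose n k := by positivity
        have := h4 (k + 1 + 1)
        have e2 : k + 1 + 1 = k + 2 := rfl
        rw [e2] at *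
        linarith
    · rintro (_ | k)
      · rw [bS, h1, h3]
        have e := mul_le_mul_of_nonneg_left (h5 0) hl
        simp only [halfChoose_zero, zero_add, pow_one, pow_zero, Nat.cast_one, mul_one] at e ⊢
        nlinarith
      · rw [bS]
        have e := mul_le_mul_of_nonneg_left (h5 (k + 1)) hl
        have e' := mul_le_mul_of_nonneg_left (h5 k) (mul_nonneg hc hl)
        have e'' := mul_le_mul_of_nonneg_left (h4 (k + 1)) hc
        -- The three terms of the recursion are at most `u`, `u / 2` and `u / 2`, which is what the
        -- factor `2` in the fluctuation bound pays for.
        set u := (2 * c) ^ (k + 2) * y ^ (k + 1) * halfChoose n (k + 1) with hu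
        have hu0 : 0 ≤ u := by positivity
        have g1 : lam * (2 * (2 * c) ^ (k + 1 + 1) * y ^ (k + 1) * halfChoose n (k + 1)) ≤ u := by
          have : lam * (2 * (2 * c) ^ (k + 1 + 1) * y ^ (k + 1) * halfChoose n (k + 1)) =
            2 * lam * u := by rw [hu]; ring
          rw [this]
          exact mul_le_of_le_one_left hu0 hl2
        have g2 : c * ((2 * c) ^ (k + 1) * y ^ (k + 1) * halfChoose n (k + 1)) = 1 / 2 * u := by
          rw [hu]; ring
        have g3 : c * lam * (2 * (2 * c) ^ (k + 1) * y ^ k * halfChoose n k) ≤ 1 / 2 * u := by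
          have : c * lam * (2 * (2 * c) ^ (k + 1) * y ^ k * halfChoose n k) =
              1 / 2 * ((2 * c) ^ (k + 2) * (y ^ (k + 1) * y) * halfChoose n k) := by
            rw [← pow_succ, pow_add y k 2, hlam]; ring
          rw [this, hu]
          have hm : (halfChoose n k : ℝ) ≤ halfChoose n (k + 1) := by
            exact_mod_cast halfChoose_mono_right n k.le_succ
          have hyy : y ^ (k + 1) * y ≤ y ^ (k + 1) := mul_le_of_le_one_right (by positivity) hy1
          gcongr
        have g4 : 2 * u ≤ 2 * (2 * c) ^ (k + 1 + 1) * y ^ (k + 1) * halfChoose (n + 1) (k + 1) := by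
          have hm : (halfChoose n (k + 1) : ℝ) ≤ halfChoose (n + 1) (k + 1) := by
            exact_mod_cast halfChoose_mono_left (k + 1) n.le_succ
          rw [hu, ← mul_assoc, ← mul_assoc]
          gcongr
        linarith

theorem levelSum_walkBound_le {lam c y : ℝ} (hc : 0 ≤ c) (hy : 0 ≤ y) (hy1 : y ≤ 1)
    (hlam : y ^ 2 = 2 * lam) (n k : ℕ) :
    levelSum (fun B => (walkBound lam c n B).1) k ≤
      (4 * c * y) ^ k * Real.sqrt (n.choose k) := by
  rcases le_or_gt k n with hk | hk
  · refine ((levelSum_walkBound hc hy hy1 hlam n).2.2.2.1 k).trans ?_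
    calc _ ≤ (2 * c) ^ k * y ^ k * (2 ^ k * Real.sqrt (n.choose k)) := by
          gcongr
          exact halfChoose_le hk
      _ = _ := by rw [← mul_assoc, ← mul_pow, ← mul_pow]; ring
  · rw [levelSum, Finset.sum_eq_zero]
    · positivity
    · intro B hB
      have := patternLevel_le B
      rw [Finset.mem_filter] at hB
      omega

end Patterns

/-! ### Products and Cauchy–Schwarz for averages. -/

section Expect

theorem expect_prod_pi {S R : Type*} [Fintype S] [Field R] [CharZero R] {n : ℕ}
    (g : Fin n → S → R) :
    𝔼 x : Fin n → S, ∏ i, g i (x i) = ∏ i, 𝔼 s, g i s := by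
  simp_rw [Fintype.expect_eq_sum_div_card]
  rw [Finset.prod_div_distrib, Finset.prod_univ_sum, Fintype.piFinset_univ]
  simp

theorem norm_expect_mul_le {ι : Type*} [Fintype ι] (p : ι → ℝ) (g : ι → ℂ) :
    ‖𝔼 i, (p i : ℂ) * g i‖ ≤ Real.sqrt (𝔼 i, p i ^ 2) * Real.sqrt (𝔼 i, ‖g i‖ ^ 2) := by
  simp_rw [Fintype.expect_eq_sum_div_card]
  have h : ‖∑ i, (p i : ℂ) * g i‖ ≤ Real.sqrt (∑ i, p i ^ 2) * Real.sqrt (∑ i, ‖g i‖ ^ 2) := by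
    refine (norm_sum_le _ _).trans ?_
    simp_rw [norm_mul, Complex.norm_real, Real.norm_eq_abs]
    have := Real.sum_mul_le_sqrt_mul_sqrt Finset.univ (fun i => |p i|) fun i => ‖g i‖
    simpa only [sq_abs] using this
  rw [norm_div, Complex.norm_natCast, Real.sqrt_div (by positivity), Real.sqrt_div (by positivity),
    div_mul_div_comm, Real.mul_self_sqrt (Nat.cast_nonneg _)]
  gcongr

theorem Complex.star_expect {ι : Type*} [Fintype ι] (f : ι → ℂ) :
    star (𝔼 i, f i) = 𝔼 i, star (f i) := by
  simp_rw [Fintype.expect_eq_sum_div_card]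
  simp

end Expect

/-! ### Decomposition into pattern components, Parseval, and symmetry. -/

section Components

variable {S : Type*} [Fintype S] {n : ℕ}

/-- The tensor product of the kernels `projKernel (B i)`. -/
def prodKernel (B : Fin n → Bool) (s t : Fin n → S) : ℝ := ∏ i, projKernel (B i) (s i) (t i)

theorem prodKernel_comm (B : Fin n → Bool) (s t : Fin n → S) :
    prodKernel B s t = prodKernel B t s :=
  Finset.prod_congr rfl fun _ _ => projKernel_comm _ _ _

theorem expect_prodKernel_mul [Nonempty S] (B : Fin n → Bool) (t u : Fin n → S) :
    𝔼 s, prodKernel B s t * prodKernel B s u = prodKernel B t u := by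
  simp only [prodKernel, ← Finset.prod_mul_distrib]
  rw [expect_prod_pi (fun i s => projKernel (B i) s (t i) * projKernel (B i) s (u i))]
  simp_rw [expect_projKernel_mul]

open Classical in
theorem sum_prodKernel (t u : Fin n → S) :
    ∑ B, prodKernel B t u = if t = u then (Fintype.card (Fin n → S) : ℝ) else 0 := by
  have h := Finset.prod_univ_sum (fun _ : Fin n => (Finset.univ : Finset Bool))
    fun i b => projKernel b (t i) (u i)
  rw [Fintype.piFinset_univ] at h
  simp only [prodKernel]
  rw [← h]
  simp_rw [sum_projKernel]
  split_ifs with htu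
  · subst htu; simp
  · obtain ⟨i, hi⟩ := Function.ne_iff.mp htu
    exact Finset.prod_eq_zero (Finset.mem_univ i) (by simp [hi])

/-- The component of `f` in the tensor product of the spaces of constant functions (at `i` with
`B i = false`) and of functions of mean zero (at `i` with `B i = true`). -/
def patternComponent (f : (Fin n → S) → ℂ) (B : Fin n → Bool) (x : Fin n → S) : ℂ :=
  𝔼 t, (prodKernel B x t : ℂ) * f t

theorem sum_patternComponent (f : (Fin n → S) → ℂ) (x : Fin n → S) :
    ∑ B, patternComponent f B x = f x := by
  classical
  have : Nonempty (Fin n → S) := ⟨x⟩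
  have hne : (Fintype.card (Fin n → S) : ℂ) ≠ 0 :=
    Nat.cast_ne_zero.mpr Fintype.card_ne_zero
  simp only [patternComponent]
  rw [← Finset.expect_sum_comm]
  simp_rw [← Finset.sum_mul, ← Complex.ofReal_sum, sum_prodKernel]
  rw [Fintype.expect_eq_sum_div_card, Finset.sum_eq_single x (fun y _ hy => by simp [hy.symm])
    (fun h => absurd (Finset.mem_univ _) h)]
  rw [if_pos rfl, Complex.ofReal_natCast, mul_div_cancel_left₀ _ hne]

/-- The squared `L²` norm of a component. -/
def componentEnergy (f : (Fin n → S) → ℂ) (B : Fin n → Bool) : ℝ :=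
  𝔼 x, ‖patternComponent f B x‖ ^ 2

theorem componentEnergy_nonneg (f : (Fin n → S) → ℂ) (B : Fin n → Bool) :
    0 ≤ componentEnergy f B := Finset.expect_nonneg fun _ _ => sq_nonneg _

/-- The energy is the quadratic form of the kernel itself, by idempotence. It is therefore linear in
the kernel, which gives Parseval without checking orthogonality of distinct components. -/
theorem componentEnergy_eq [Nonempty S] (f : (Fin n → S) → ℂ) (B : Fin n → Bool) :
    (componentEnergy f B : ℂ) = 𝔼 t, 𝔼 u, (prodKernel B t u : ℂ) * (f t * star (f u)) := by
  rw [componentEnergy, Complex.ofReal_expect]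
  have h : ∀ x, ((‖patternComponent f B x‖ ^ 2 : ℝ) : ℂ) =
      𝔼 t, 𝔼 u, ((prodKernel B x t * prodKernel B x u : ℝ) : ℂ) * (f t * star (f u)) := by
    intro x
    rw [Complex.ofReal_pow, ← Complex.mul_conj', ← Complex.star_def, patternComponent,
      Complex.star_expect, Finset.expect_mul_expect]
    refine Finset.expect_congr rfl fun t _ => Finset.expect_congr rfl fun u _ => ?_
    rw [star_mul', Complex.star_def, Complex.conj_ofReal]
    push_cast
    ring
  simp_rw [h]
  rw [Finset.expect_comm]
  refine Finset.expect_congr rfl fun t _ => ?_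
  rw [Finset.expect_comm]
  refine Finset.expect_congr rfl fun u _ => ?_
  rw [← Finset.expect_mul, ← Complex.ofReal_expect, expect_prodKernel_mul]

theorem sum_componentEnergy [Nonempty S] (f : (Fin n → S) → ℂ) :
    ∑ B, componentEnergy f B = 𝔼 x, ‖f x‖ ^ 2 := by
  classical
  have hne : (Fintype.card (Fin n → S) : ℂ) ≠ 0 :=
    Nat.cast_ne_zero.mpr Fintype.card_ne_zero
  apply Complex.ofReal_injective
  rw [Complex.ofReal_sum, Complex.ofReal_expect]
  simp_rw [componentEnergy_eq]
  rw [← Finset.expect_sum_comm]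
  refine Finset.expect_congr rfl fun t _ => ?_
  rw [← Finset.expect_sum_comm]
  simp_rw [← Finset.sum_mul, ← Complex.ofReal_sum, sum_prodKernel]
  rw [Fintype.expect_eq_sum_div_card, Finset.sum_eq_single t (fun y _ hy => by simp [hy.symm])
    (fun h => absurd (Finset.mem_univ _) h)]
  rw [if_pos rfl, Complex.ofReal_natCast, mul_div_cancel_left₀ _ hne, Complex.star_def,
    Complex.mul_conj', Complex.ofReal_pow]

theorem componentEnergy_comp_perm [Nonempty S] {f : (Fin n → S) → ℂ} (hf : IsSymmetricFun f)
    (B : Fin n → Bool) (σ : Equiv.Perm (Fin n)) :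
    componentEnergy f (B ∘ σ) = componentEnergy f B := by
  apply Complex.ofReal_injective
  rw [componentEnergy_eq, componentEnergy_eq]
  symm
  let e : (Fin n → S) ≃ (Fin n → S) := σ.symm.arrowCongr (Equiv.refl S)
  have he : ∀ x, e x = x ∘ σ := fun x => rfl
  refine Fintype.expect_equiv e _ _ fun t => Fintype.expect_equiv e _ _ fun u => ?_
  rw [he, he, hf, hf]
  congr 2
  exact (Equiv.prod_comp σ fun i => projKernel (B i) (t i) (u i)).symm

theorem patternLevel_eq_card (B : Fin n → Bool) :
    patternLevel B = Fintype.card {i // B i = true} := by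
  rw [Fintype.card_subtype, Finset.card_filter, patternLevel]
  refine Finset.sum_congr rfl fun i _ => ?_
  cases B i <;> rfl

theorem exists_perm_of_patternLevel_eq {B C : Fin n → Bool} (h : patternLevel B = patternLevel C) :
    ∃ σ : Equiv.Perm (Fin n), C = B ∘ σ := by
  rw [patternLevel_eq_card, patternLevel_eq_card] at h
  let e : {i // C i = true} ≃ {i // B i = true} := Fintype.equivOfCardEq h.symm
  refine ⟨e.extendSubtype, funext fun i => ?_⟩
  by_cases hi : C i = true
  · rw [hi, Function.comp_apply, e.extendSubtype_mem i hi]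
  · have := e.extendSubtype_not_mem i hi
    rw [Bool.not_eq_true] at hi this
    rw [hi, Function.comp_apply, this]

theorem levelSum_one (n k : ℕ) : levelSum (fun _ : Fin n → Bool => 1) k = n.choose k := by
  induction n generalizing k with
  | zero => cases k <;> simp [levelSum_zero_left]
  | succ n ih =>
    cases k with
    | zero => rw [levelSum_succ_zero, ih]; simp
    | succ k => rw [levelSum_succ_succ, ih, ih, Nat.choose_succ_succ, add_comm]

/-- The patterns of a level form one orbit under permutations of the coordinates, and symmetry of
`f` makes the energy constant on it. -/
theorem levelSum_componentEnergy [Nonempty S] {f : (Fin n → S) → ℂ} (hf : IsSymmetricFun f)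
    (B : Fin n → Bool) :
    levelSum (componentEnergy f) (patternLevel B) =
      n.choose (patternLevel B) * componentEnergy f B := by
  have h : ∀ C ∈ Finset.univ.filter (fun C : Fin n → Bool => patternLevel C = patternLevel B),
      componentEnergy f C = componentEnergy f B := by
    intro C hC
    obtain ⟨σ, rfl⟩ := exists_perm_of_patternLevel_eq (Finset.mem_filter.mp hC).2.symm
    exact componentEnergy_comp_perm hf B σ
  rw [levelSum, Finset.sum_congr rfl h, Finset.sum_const, nsmul_eq_mul, ← levelSum_one, levelSum,
    Finset.card_eq_sum_ones]

theorem sum_range_levelSum {M : Type*} [AddCommMonoid M] (F : (Fin n → Bool) → M) :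
    ∑ k ∈ Finset.range (n + 1), levelSum F k = ∑ B, F B :=
  Finset.sum_fiberwise_of_maps_to
    (fun B _ => Finset.mem_range.mpr (Nat.lt_succ_of_le (patternLevel_le B))) F

end Components

/-! ### From components to the walk error. -/

namespace RegularMultigraph

variable {V : Type*} [Fintype V] {d : ℕ} {S : Type*}

theorem walkProb_cons (X : RegularMultigraph V d) {n : ℕ} (v : V) (x : Fin n → V) :
    X.walkProb (Fin.cons v x : Fin (n + 1) → V) = (Fintype.card V : ℝ)⁻¹ *
      ∏ i : Fin n, X.normAdj ((Fin.cons v x : Fin (n + 1) → V) i.castSucc) (x i) := by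
  rw [walkProb, Fin.prod_univ_succ]
  simp only [Fin.val_zero, if_true, Fin.val_succ, Nat.succ_ne_zero, if_false, Fin.cons_succ]
  rfl

theorem sum_prod_normAdj_mul_prodKernel [Fintype S] (hd : 0 < d) (X : RegularMultigraph V d)
    (φ : V → S) :
    ∀ (n : ℕ) (B : Fin (n + 1) → Bool) (t : Fin (n + 1) → S) (v : V),
      ∑ x : Fin n → V, (∏ i : Fin n, X.normAdj ((Fin.cons v x : Fin (n + 1) → V) i.castSucc) (x i)) *
        prodKernel B t (φ ∘ (Fin.cons v x : Fin (n + 1) → V)) = X.walkTransform φ (n + 1) B t v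
  | 0, B, t, v => by
    simp only [walkTransform, mul_one]
    -- `walkTransform` takes one step beyond the last vertex; this is harmless because the rows of
    -- the matrix sum to `1`.
    rw [Fintype.sum_unique, X.sum_normAdj hd, mul_one, prodKernel, Fin.prod_univ_succ]
    simp
  | n + 1, B, t, v => by
    rw [sum_fin_succ, walkTransform, Finset.mul_sum]
    refine Finset.sum_congr rfl fun y _ => ?_
    rw [← sum_prod_normAdj_mul_prodKernel hd X φ n (Fin.tail B) (Fin.tail t) y, Finset.mul_sum,
      Finset.mul_sum]
    refine Finset.sum_congr rfl fun x _ => ?_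
    rw [Fin.prod_univ_succ, prodKernel, Fin.prod_univ_succ]
    simp only [Fin.castSucc_zero, Fin.cons_zero, Function.comp_apply, Fin.cons_succ,
      ← Fin.succ_castSucc]
    rw [prodKernel]
    simp only [Fin.tail, Function.comp_apply]
    ring


theorem expect_prodKernel_comp [Fintype S] [Nonempty V] {φ : V → S} (hφ : IsUnbiased φ) {n : ℕ}
    {B : Fin n → Bool} (hB : patternLevel B ≠ 0) (t : Fin n → S) :
    𝔼 y : Fin n → V, prodKernel B t (φ ∘ y) = 0 := by
  obtain ⟨i, -, hi⟩ := Finset.exists_ne_zero_of_sum_ne_zero hB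
  have hi : B i = true := by cases h : B i <;> simp_all
  simp only [prodKernel, Function.comp_apply]
  rw [expect_prod_pi fun i v => projKernel (B i) (t i) (φ v)]
  refine Finset.prod_eq_zero (Finset.mem_univ i) ?_
  rw [hi, hφ.expect_projKernel]

theorem sum_walkProb_mul_prodKernel [Fintype S] [Nonempty V] (hd : 0 < d)
    (X : RegularMultigraph V d) (φ : V → S) {n : ℕ} (B : Fin n → Bool) (t : Fin n → S) :
    ∑ x, X.walkProb x * prodKernel B t (φ ∘ x) = 𝔼 v, X.walkTransform φ n B t v := by
  cases n with
  | zero => simp [walkProb, prodKernel, walkTransform]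
  | succ n =>
    rw [sum_fin_succ, Fintype.expect_eq_sum_div_card, Finset.sum_div]
    refine Finset.sum_congr rfl fun v _ => ?_
    rw [← X.sum_prod_normAdj_mul_prodKernel hd, Finset.sum_div]
    refine Finset.sum_congr rfl fun x _ => ?_
    rw [walkProb_cons]
    ring

theorem walkTransform_false [Fintype S] (hd : 0 < d) (X : RegularMultigraph V d) (φ : V → S) :
    ∀ (n : ℕ) (t : Fin n → S) (v : V), X.walkTransform φ n (fun _ => false) t v = 1
  | 0, _, _ => rfl
  | n + 1, t, v => by
    have : Fin.tail (fun _ : Fin (n + 1) => false) = fun _ => false := rfl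
    simp only [walkTransform, projKernel_false, this, walkTransform_false hd X φ n, mul_one]
    rw [one_mul]
    exact X.sum_normAdj hd v

theorem sum_walkProb [Nonempty V] (hd : 0 < d) (X : RegularMultigraph V d) (n : ℕ) :
    ∑ x : Fin n → V, X.walkProb x = 1 := by
  -- On a one-point alphabet with nothing marked, the kernel is `1` and the pairing is the total
  -- mass.
  have h := X.sum_walkProb_mul_prodKernel hd (fun _ => ()) (fun _ : Fin n => false) fun _ => ()
  simpa [X.walkTransform_false hd, prodKernel, projKernel_false] using h

theorem walkError_const [Nonempty V] (hd : 0 < d) (X : RegularMultigraph V d) (φ : V → S) {n : ℕ}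
    (c : ℂ) : X.walkError φ (fun _ : Fin n → S => c) = 0 := by
  rw [walkError, ← Finset.sum_mul, ← Complex.ofReal_sum, X.sum_walkProb hd, Fintype.expect_const]
  simp

theorem walkError_sum (X : RegularMultigraph V d) (φ : V → S) {n : ℕ} {ι : Type*} (s : Finset ι)
    (F : ι → (Fin n → S) → ℂ) :
    X.walkError φ (fun x => ∑ i ∈ s, F i x) = ∑ i ∈ s, X.walkError φ (F i) := by
  simp only [walkError]
  rw [Finset.sum_sub_distrib, Finset.expect_sum_comm, Finset.sum_comm]
  simp_rw [Finset.mul_sum]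

variable [Fintype S] [Nonempty V]

theorem walkError_patternComponent_of_level_zero (hd : 0 < d) (X : RegularMultigraph V d)
    (φ : V → S) {n : ℕ} (f : (Fin n → S) → ℂ) {B : Fin n → Bool} (hB : patternLevel B = 0) :
    X.walkError φ (patternComponent f B) = 0 := by
  have hB' : ∀ i, B i = false := by
    intro i
    have := Finset.sum_eq_zero_iff.mp hB i (Finset.mem_univ i)
    cases h : B i <;> simp_all
  have : patternComponent f B = fun _ => 𝔼 t, f t := by
    funext x
    simp [patternComponent, prodKernel, hB', projKernel_false]
  rw [this, walkError_const hd]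

/-- Independent vertices contribute nothing because a marked factor averages to zero. For the walk,
idempotence allows one more copy of the kernel to be inserted, and the walk average is moved onto
that copy. -/
theorem walkError_patternComponent [Nonempty S] (hd : 0 < d) (X : RegularMultigraph V d)
    {φ : V → S} (hφ : IsUnbiased φ) {n : ℕ} (f : (Fin n → S) → ℂ) {B : Fin n → Bool}
    (hB : patternLevel B ≠ 0) :
    X.walkError φ (patternComponent f B) =
      𝔼 u, ((𝔼 v, X.walkTransform φ n B u v : ℝ) : ℂ) * patternComponent f B u := by
  have h2 : 𝔼 y : Fin n → V, patternComponent f B (φ ∘ y) = 0 := by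
    simp only [patternComponent]
    rw [Finset.expect_comm]
    refine Finset.expect_eq_zero fun t _ => ?_
    simp_rw [prodKernel_comm B _ t]
    rw [← Finset.expect_mul, ← Complex.ofReal_expect, expect_prodKernel_comp hφ hB]
    simp
  rw [walkError, h2, sub_zero]
  have h3 : ∀ x, patternComponent f B x = 𝔼 u, (prodKernel B u x : ℂ) * patternComponent f B u := by
    intro x
    simp only [patternComponent]
    simp_rw [Finset.mul_expect]
    rw [Finset.expect_comm]
    refine Finset.expect_congr rfl fun t _ => ?_
    simp_rw [← mul_assoc]
    rw [← Finset.expect_mul, ← expect_prodKernel_mul B x t, Complex.ofReal_expect]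
    push_cast
    rfl
  calc ∑ x, (X.walkProb x : ℂ) * patternComponent f B (φ ∘ x)
      = ∑ x, 𝔼 u, ((X.walkProb x : ℂ) * prodKernel B u (φ ∘ x)) * patternComponent f B u := by
        refine Finset.sum_congr rfl fun x _ => ?_
        rw [h3, Finset.mul_expect]
        simp_rw [mul_assoc]
    _ = 𝔼 u, (∑ x, (X.walkProb x : ℂ) * prodKernel B u (φ ∘ x)) * patternComponent f B u := by
        rw [← Finset.expect_sum_comm]
        simp_rw [Finset.sum_mul]
    _ = _ := by
        refine Finset.expect_congr rfl fun u _ => ?_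
        rw [← X.sum_walkProb_mul_prodKernel hd]
        push_cast
        rfl

theorem norm_walkError_patternComponent_le [Nonempty S] (hd : 0 < d) (X : RegularMultigraph V d)
    {lam : ℝ} (hlam : 0 ≤ lam) (hlam1 : lam < 1) (hX : X.IsExpander lam)
    {φ : V → S} (hφ : IsUnbiased φ) {n : ℕ} (f : (Fin n → S) → ℂ) {B : Fin n → Bool}
    (hB : patternLevel B ≠ 0) :
    ‖X.walkError φ (patternComponent f B)‖ ≤
      (walkBound lam (Real.sqrt (Fintype.card S)) n B).1 * Real.sqrt (componentEnergy f B) := by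
  rw [X.walkError_patternComponent hd hφ f hB]
  refine (norm_expect_mul_le _ _).trans ?_
  refine mul_le_mul_of_nonneg_right ?_ (Real.sqrt_nonneg _)
  refine Real.sqrt_le_iff.mpr
    ⟨(walkBound_nonneg hlam (Real.sqrt_nonneg _) n B).1, ?_⟩
  exact (X.walkTransform_bound hd hlam hlam1 hX hφ n B).1

/-- With `4 * c * y` equal to the square root on the right, the walk bounds sum to its `k`-th power
times `√(n choose k)`. The common component energy is the level energy divided by `n choose k`, so
the two factors combine exactly. -/
theorem norm_walkError_levelSum_le [Nonempty S] (hd : 0 < d) (X : RegularMultigraph V d)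
    {lam : ℝ} (hlam : 0 ≤ lam) (hlam2 : lam ≤ 1 / 2) (hX : X.IsExpander lam)
    {φ : V → S} (hφ : IsUnbiased φ) {n : ℕ} {f : (Fin n → S) → ℂ} (hf : IsSymmetricFun f)
    {k : ℕ} (hk : k ≠ 0) :
    ‖X.walkError φ (fun x => levelSum (fun B => patternComponent f B x) k)‖ ≤
      Real.sqrt (32 * lam * Fintype.card S) ^ k *
        Real.sqrt (levelSum (componentEnergy f) k) := by
  set c := Real.sqrt (Fintype.card S)
  set y := Real.sqrt (2 * lam)
  have hy : y ^ 2 = 2 * lam := Real.sq_sqrt (by positivity)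
  have hy1 : y ≤ 1 := Real.sqrt_le_one.mpr (by linarith)
  have hq : Real.sqrt (32 * lam * Fintype.card S) = 4 * c * y := by
    rw [Real.sqrt_eq_iff_mul_self_eq (by positivity) (by positivity)]
    have hc : c ^ 2 = Fintype.card S := Real.sq_sqrt (Nat.cast_nonneg _)
    calc 32 * lam * Fintype.card S = 16 * c ^ 2 * y ^ 2 := by rw [hc, hy]; ring
      _ = _ := by ring
  have hA := levelSum_walkBound_le (Real.sqrt_nonneg (Fintype.card S : ℝ))
    (Real.sqrt_nonneg (2 * lam)) hy1 hy n k
  simp only [levelSum]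
  rw [X.walkError_sum]
  refine (norm_sum_le _ _).trans ?_
  rcases (Finset.univ.filter fun B : Fin n → Bool => patternLevel B = k).eq_empty_or_nonempty
    with h0 | ⟨B₀, hB₀⟩
  · simp [h0]
  have hk₀ : patternLevel B₀ = k := (Finset.mem_filter.mp hB₀).2
  have hE : ∀ B ∈ Finset.univ.filter (fun B : Fin n → Bool => patternLevel B = k),
      ‖X.walkError φ (patternComponent f B)‖ ≤
        (walkBound lam c n B).1 * Real.sqrt (componentEnergy f B₀) := by
    intro B hB
    have hBk := (Finset.mem_filter.mp hB).2
    obtain ⟨σ, rfl⟩ := exists_perm_of_patternLevel_eq (hk₀.trans hBk.symm)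
    rw [← componentEnergy_comp_perm hf B₀ σ]
    exact X.norm_walkError_patternComponent_le hd hlam (by linarith) hX hφ f (by omega)
  refine (Finset.sum_le_sum hE).trans ?_
  rw [← Finset.sum_mul]
  have hL : levelSum (componentEnergy f) k = n.choose k * componentEnergy f B₀ := by
    rw [← hk₀]; exact levelSum_componentEnergy hf B₀
  change levelSum (fun B => (walkBound lam c n B).1) k * _ ≤ _ * Real.sqrt (levelSum _ k)
  rw [hL, Real.sqrt_mul (Nat.cast_nonneg _), ← mul_assoc, hq]
  exact mul_le_mul_of_nonneg_right hA (Real.sqrt_nonneg _)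

/-- One mark moves the transform out of the mean and no second mark brings it back. The nonnegative
mean bounds at level one sum to zero, so each of them vanishes. -/
theorem walkError_levelSum_one [Nonempty S] (hd : 0 < d) (X : RegularMultigraph V d)
    {lam : ℝ} (hlam : 0 ≤ lam) (hlam2 : lam ≤ 1 / 2) (hX : X.IsExpander lam)
    {φ : V → S} (hφ : IsUnbiased φ) {n : ℕ} (f : (Fin n → S) → ℂ) :
    X.walkError φ (fun x => levelSum (fun B => patternComponent f B x) 1) = 0 := by
  set c := Real.sqrt (Fintype.card S)
  have hnn := fun B => (walkBound_nonneg hlam (Real.sqrt_nonneg (Fintype.card S : ℝ)) n B).1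
  have h := (levelSum_walkBound (Real.sqrt_nonneg (Fintype.card S : ℝ))
    (Real.sqrt_nonneg (2 * lam)) (Real.sqrt_le_one.mpr (by linarith))
    (Real.sq_sqrt (by positivity)) n).2.1
  rw [levelSum, Finset.sum_eq_zero_iff_of_nonneg fun B _ => hnn B] at h
  simp only [levelSum]
  rw [X.walkError_sum]
  refine Finset.sum_eq_zero fun B hB => ?_
  have hB1 := (Finset.mem_filter.mp hB).2
  have := X.norm_walkError_patternComponent_le hd hlam (by linarith) hX hφ f
    (B := B) (by omega)
  rw [h B hB, zero_mul] at this
  exact norm_le_zero_iff.mp this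

theorem walkError_levelSum_zero (hd : 0 < d) (X : RegularMultigraph V d) (φ : V → S) {n : ℕ}
    (f : (Fin n → S) → ℂ) :
    X.walkError φ (fun x => levelSum (fun B => patternComponent f B x) 0) = 0 := by
  simp only [levelSum]
  rw [X.walkError_sum]
  exact Finset.sum_eq_zero fun B hB =>
    X.walkError_patternComponent_of_level_zero hd φ f (Finset.mem_filter.mp hB).2

theorem norm_walkError_levelSum_le_normTwo [Nonempty S] (hd : 0 < d) (X : RegularMultigraph V d)
    {lam : ℝ} (hlam : 0 ≤ lam) (hlam2 : lam ≤ 1 / 2) (hX : X.IsExpander lam)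
    {φ : V → S} (hφ : IsUnbiased φ) {n : ℕ} {f : (Fin n → S) → ℂ} (hf : IsSymmetricFun f)
    {k : ℕ} (hk : k ≠ 0) {τ : ℝ} (hτ : τ = 16 * Real.exp 1 * lam * Fintype.card S) :
    ‖X.walkError φ (fun x => levelSum (fun B => patternComponent f B x) k)‖ ≤
      τ ^ ((k : ℝ) / 2) * normTwo f := by
  have hexp : 2 ≤ Real.exp 1 := by linarith [Real.exp_one_gt_d9]
  have hθ : 32 * lam * Fintype.card S ≤ τ := by
    rw [hτ]
    gcongr
    linarith
  have hτ0 : 0 ≤ τ := le_trans (by positivity) hθ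
  have hpow : τ ^ ((k : ℝ) / 2) = Real.sqrt τ ^ k := by
    rw [Real.sqrt_eq_rpow, ← Real.rpow_natCast, ← Real.rpow_mul hτ0]
    ring_nf
  rw [hpow]
  refine (X.norm_walkError_levelSum_le hd hlam hlam2 hX hφ hf hk).trans ?_
  have hle : levelSum (componentEnergy f) k ≤ 𝔼 x, ‖f x‖ ^ 2 := by
    rw [← sum_componentEnergy]
    exact Finset.sum_le_univ_sum_of_nonneg (componentEnergy_nonneg f)
  rw [normTwo]
  gcongr

theorem norm_walkError_le [Nonempty S] (hd : 0 < d) (X : RegularMultigraph V d)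
    {lam : ℝ} (hlam : 0 ≤ lam) (hX : X.IsExpander lam)
    {φ : V → S} (hφ : IsUnbiased φ) {n : ℕ} {f : (Fin n → S) → ℂ} (hf : IsSymmetricFun f)
    {τ : ℝ} (hτ : τ = 16 * Real.exp 1 * lam * Fintype.card S) (hτ1 : τ < 1) :
    ‖X.walkError φ f‖ ≤ 2 * τ * normTwo f := by
  -- Replacing `32` by `16 * e` gains the factor `e / 2 ≥ 1.35`; this keeps `θ` away from `1` when
  -- `τ < 1`.
  have hexp : 2.7 ≤ Real.exp 1 := by linarith [Real.exp_one_gt_d9]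
  set θ := 32 * lam * Fintype.card S with hθ
  have hθ0 : 0 ≤ θ := by positivity
  have hθτ : 1.35 * θ ≤ τ := by
    have hls : 0 ≤ lam * Fintype.card S := by positivity
    rw [hτ, hθ]
    nlinarith [mul_le_mul_of_nonneg_right hexp hls]
  have hτ0 : 0 ≤ τ := by linarith
  have hlam2 : lam ≤ 1 / 2 := by
    have hS : (1 : ℝ) ≤ Fintype.card S := by exact_mod_cast Fintype.card_pos
    nlinarith [mul_le_mul_of_nonneg_left hS hlam]
  have hsplit : X.walkError φ f = ∑ k ∈ Finset.range (n + 1),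
      X.walkError φ (fun x => levelSum (fun B => patternComponent f B x) k) := by
    rw [← X.walkError_sum]
    congr 1
    funext x
    rw [sum_range_levelSum, sum_patternComponent]
  set q := Real.sqrt θ
  have hq : q ^ 2 = θ := Real.sq_sqrt hθ0
  -- Setting the weights to zero at levels `0` and `1` starts the geometric series at `θ ^ 2`, so
  -- the final bound is linear in `τ`.
  let w : ℕ → ℝ := fun k => if k < 2 then 0 else q ^ k
  have hterm : ∀ k ∈ Finset.range (n + 1),
      ‖X.walkError φ (fun x => levelSum (fun B => patternComponent f B x) k)‖ ≤
        w k * Real.sqrt (levelSum (componentEnergy f) k) := by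
    rintro (_ | _ | k) -
    · rw [X.walkError_levelSum_zero hd]; simp [w]
    · rw [zero_add, X.walkError_levelSum_one hd hlam hlam2 hX hφ]; simp [w]
    · have : w (k + 1 + 1) = q ^ (k + 1 + 1) := if_neg (by omega)
      rw [this]
      exact X.norm_walkError_levelSum_le hd hlam hlam2 hX hφ hf (by omega)
  have hE : ∀ k, 0 ≤ levelSum (componentEnergy f) k := fun k =>
    Finset.sum_nonneg fun B _ => componentEnergy_nonneg f B
  have hw : ∀ m : ℕ, ∑ k ∈ Finset.range m, w k ^ 2 ≤ θ ^ 2 / (1 - θ) := by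
    intro m
    have hθ1 : θ < 1 := by linarith
    have h2 : ∀ m, ∑ k ∈ Finset.range m, w (k + 2) ^ 2 ≤ θ ^ 2 / (1 - θ) := by
      intro m
      have : ∀ k, w (k + 2) ^ 2 = θ ^ 2 * θ ^ k := by
        intro k
        have : w (k + 2) = q ^ (k + 2) := if_neg (by omega)
        rw [this, ← pow_mul, mul_comm, pow_mul, hq, ← pow_add, add_comm]
      simp_rw [this]
      rw [← Finset.mul_sum, div_eq_mul_inv]
      refine mul_le_mul_of_nonneg_left ?_ (sq_nonneg _)
      rw [← tsum_geometric_of_lt_one hθ0 hθ1]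
      exact (summable_geometric_of_lt_one hθ0 hθ1).sum_le_tsum _ fun k _ => pow_nonneg hθ0 k
    calc _ ≤ ∑ k ∈ Finset.range (m + 2), w k ^ 2 :=
          Finset.sum_le_sum_of_subset_of_nonneg (Finset.range_mono (by omega))
            fun _ _ _ => sq_nonneg _
      _ = ∑ k ∈ Finset.range m, w (k + 2) ^ 2 := by
          rw [Finset.sum_range_succ', Finset.sum_range_succ']
          simp [w]
      _ ≤ _ := h2 m
  rw [hsplit]
  refine (norm_sum_le _ _).trans ((Finset.sum_le_sum hterm).trans ?_)
  refine (Real.sum_mul_le_sqrt_mul_sqrt _ _ _).trans ?_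
  simp_rw [Real.sq_sqrt (hE _)]
  rw [sum_range_levelSum, sum_componentEnergy]
  refine mul_le_mul_of_nonneg_right ?_ (Real.sqrt_nonneg _)
  refine Real.sqrt_le_iff.mpr ⟨by positivity, (hw _).trans ?_⟩
  -- From `θ < 1 / 1.35` follows `1 - θ ≥ 1 / 4`, whence `θ ^ 2 / (1 - θ) ≤ (2 * τ) ^ 2`.
  rw [div_le_iff₀ (by linarith)]
  have h1 : (1.35 * θ) ^ 2 ≤ τ ^ 2 := pow_le_pow_left₀ (by linarith) hθτ 2
  have h3 : (0.25 : ℝ) ≤ 1 - θ := by linarith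
  nlinarith [mul_le_mul_of_nonneg_left h3 (sq_nonneg τ)]

end RegularMultigraph

/-! ### Completeness of the irreducible characters. -/

section Subrepresentations

variable {k G V W : Type*} [Field k] [Group G] [AddCommGroup V] [Module k V]
  [AddCommGroup W] [Module k W]

theorem Representation.Equiv.isIrreducible {ρ : Representation k G V} {σ : Representation k G W}
    (e : ρ.Equiv σ) (h : ρ.IsIrreducible) : σ.IsIrreducible := by
  have he : ∀ g v, e.toLinearEquiv (ρ g v) = σ g (e.toLinearEquiv v) := fun g v =>
    e.toIntertwiningMap.isIntertwining _ _ g v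
  refine (OrderIso.isSimpleOrder_iff (α := Subrepresentation ρ) (β := Subrepresentation σ)
    { toFun := fun U => ⟨U.toSubmodule.map e.toLinearEquiv.toLinearMap, ?_⟩
      invFun := fun U => ⟨U.toSubmodule.comap e.toLinearEquiv.toLinearMap, ?_⟩
      left_inv := fun U => Subrepresentation.toSubmodule_injective ?_
      right_inv := fun U => Subrepresentation.toSubmodule_injective ?_
      map_rel_iff' := ?_ }).mp h
  · rintro g _ ⟨v, hv, rfl⟩
    exact ⟨ρ g v, U.apply_mem_toSubmodule g hv, he g v⟩
  · intro g v hv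
    change e.toLinearEquiv (ρ g v) ∈ U.toSubmodule
    rw [he]
    exact U.apply_mem_toSubmodule g hv
  · exact Submodule.comap_map_eq_of_injective e.toLinearEquiv.injective _
  · exact Submodule.map_comap_eq_of_surjective e.toLinearEquiv.surjective _
  · intro U U'
    exact Submodule.map_le_map_iff_of_injective e.toLinearEquiv.injective _ _

end Subrepresentations

section Unitary

variable {G E : Type*} [Group G] [NormedAddCommGroup E] [InnerProductSpace ℂ E]

/-- A representation by isometries of an inner product space. -/
def Representation.IsIsometric (R : Representation ℂ G E) : Prop :=
  ∀ g v w, inner ℂ (R g v) (R g w) = inner ℂ v w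

variable [FiniteDimensional ℂ E] {R : Representation ℂ G E}

/-- The unitary matrices of an isometric representation in an orthonormal basis. -/
def Representation.IsIsometric.unitaryHom (hR : R.IsIsometric) :
    G →* Matrix.unitaryGroup (Fin (Module.finrank ℂ E)) ℂ where
  toFun g := ⟨LinearMap.toMatrixOrthonormal (stdOrthonormalBasis ℂ E) (R g), by
    rw [Matrix.mem_unitaryGroup_iff', ← map_star, ← map_mul]
    have : star (R g) * R g = 1 := by
      refine LinearMap.ext fun v => ext_inner_left ℂ fun w => ?_
      rw [LinearMap.star_eq_adjoint, Module.End.mul_apply, LinearMap.adjoint_inner_right, hR]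
      rfl
    rw [this, map_one]⟩
  map_one' := Subtype.ext (by simp)
  map_mul' g h := Subtype.ext
    ((congrArg (LinearMap.toMatrixOrthonormal _) (map_mul R g h)).trans (map_mul _ _ _))

/-- An isometric representation is equivalent to the representation by its unitary matrices. -/
def Representation.IsIsometric.equivUnitaryRep (hR : R.IsIsometric) :
    R.Equiv (unitaryRep hR.unitaryHom) :=
  Representation.Equiv.mk (stdOrthonormalBasis ℂ E).toBasis.equivFun (by
    intro g
    refine LinearMap.ext fun v => ?_
    have := LinearMap.toMatrix_mulVec_repr (stdOrthonormalBasis ℂ E).toBasis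
      (stdOrthonormalBasis ℂ E).toBasis (R g) v
    exact this.symm)

/-- An element of the center of the group algebra which is orthogonal to all irreducible
characters acts as zero on every finite-dimensional unitary representation. -/
theorem Representation.IsIsometric.sum_smul_eq_zero [Fintype G] {c : G → ℂ}
    (hc : ∀ g h, c (h * g * h⁻¹) = c g)
    (horth : ∀ ρ : UnitaryIrrep G, ∑ g, c g * (unitaryRep ρ.hom).character g = 0) :
    ∀ (n : ℕ) (E : Type*) [NormedAddCommGroup E] [InnerProductSpace ℂ E] [FiniteDimensional ℂ E]
      (R : Representation ℂ G E), R.IsIsometric → Module.finrank ℂ E = n →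
      ∑ g, c g • R g = 0 := by
  intro n
  induction n using Nat.strong_induction_on with
  | _ n ih =>
  intro E _ _ _ R hR hn
  by_cases hirr : R.IsIrreducible
  · let ρ : UnitaryIrrep G := ⟨_, hR.unitaryHom, hR.equivUnitaryRep.isIrreducible hirr⟩
    have hchar : ∑ g, c g * R.character g = 0 := by
      rw [Representation.char_iso hR.equivUnitaryRep]
      exact horth ρ
    -- As `c` is a class function, the sum commutes with the action. By Schur's lemma it is a
    -- scalar, and its trace vanishes because `c` is orthogonal to the character of `R`.
    let T : R.IntertwiningMap R := ⟨∑ g, c g • R g, by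
      intro h
      refine LinearMap.ext fun v => ?_
      simp only [LinearMap.comp_apply, LinearMap.sum_apply, LinearMap.smul_apply, map_sum,
        map_smul]
      rw [← Equiv.sum_comp (MulAut.conj h).toEquiv]
      refine Finset.sum_congr rfl fun g _ => ?_
      simp only [MulEquiv.toEquiv_eq_coe, MulEquiv.coe_toEquiv, MulAut.conj_apply, hc,
        ← Module.End.mul_apply, ← map_mul]
      simp⟩
    obtain ⟨a, ha⟩ :=
      (Representation.IsIrreducible.algebraMap_intertwiningMap_bijective_of_isAlgClosed
        (ρ := R)).2 T
    have hT : ∑ g, c g • R g = a • LinearMap.id := by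
      refine LinearMap.ext fun v => ?_
      exact (congrArg (fun S : R.IntertwiningMap R => S v) ha).symm
    have htr := congrArg (LinearMap.trace ℂ E) hT
    rw [map_sum, map_smul, LinearMap.trace_id] at htr
    simp only [map_smul, smul_eq_mul] at htr
    have hdim : (Module.finrank ℂ E : ℂ) ≠ 0 := by
      have : Nontrivial E := by
        by_contra h
        rw [not_nontrivial_iff_subsingleton] at h
        have hbt : (⊥ : Subrepresentation R) ≠ ⊤ := bot_ne_top
        exact hbt (SetLike.ext fun x => by
          rw [Subsingleton.elim x 0]
          exact iff_of_true (Submodule.zero_mem _) (Submodule.zero_mem _))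
      exact_mod_cast Module.finrank_pos.ne'
    have ha0 : a = 0 := by
      have : a * Module.finrank ℂ E = 0 := by rw [← htr]; exact hchar
      exact (mul_eq_zero.mp this).resolve_right hdim
    rw [hT, ha0, zero_smul]
  · have hsplit : (∃ U : Subrepresentation R, U.toSubmodule ≠ ⊥ ∧ U.toSubmodule ≠ ⊤) ∨
        Subsingleton E := by
      by_contra! h
      obtain ⟨h1, h2⟩ := h
      refine hirr { exists_pair_ne := ⟨⊥, ⊤, fun h => ?_⟩, eq_bot_or_eq_top := fun U => ?_ }
      · exact bot_ne_top (α := Submodule ℂ E) (congrArg Subrepresentation.toSubmodule h)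
      · by_cases hU : U.toSubmodule = ⊥
        · exact Or.inl (Subrepresentation.toSubmodule_injective hU)
        · exact Or.inr (Subrepresentation.toSubmodule_injective (h1 U hU))
    rcases hsplit with ⟨U, hU0, hU1⟩ | hE
    · let U' : Subrepresentation R := ⟨U.toSubmoduleᗮ, by
        intro g v hv w hw
        have h1 := hR g (R g⁻¹ w) v
        rw [← Module.End.mul_apply, ← map_mul, mul_inv_cancel, map_one, Module.End.one_apply] at h1
        rw [h1]
        exact hv _ (U.apply_mem_toSubmodule g⁻¹ hw)⟩
      have hzero : ∀ W : Subrepresentation R, W.toSubmodule ≠ ⊤ → ∀ v ∈ W.toSubmodule,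
          (∑ g, c g • R g) v = 0 := by
        intro W hW v hv
        have := ih _ (hn ▸ Submodule.finrank_lt hW) W.toSubmodule W.toRepresentation
          (fun g x y => hR g x y) rfl
        have h2 := congrArg (fun f : W.toSubmodule →ₗ[ℂ] W.toSubmodule =>
          ((f ⟨v, hv⟩ : W.toSubmodule) : E)) this
        simp only [LinearMap.sum_apply, LinearMap.smul_apply, Submodule.coe_sum,
          Submodule.coe_smul, LinearMap.zero_apply, Submodule.coe_zero] at h2 ⊢
        exact h2
      refine LinearMap.ext fun v => ?_
      obtain ⟨x, hx, y, hy, rfl⟩ := Submodule.exists_add_mem_mem_orthogonal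
        (K := U.toSubmodule) v
      rw [map_add, hzero U hU1 x hx, hzero U' _ y hy]
      · simp
      · intro h
        have h' : U.toSubmoduleᗮ = ⊤ := h
        rw [← U.toSubmodule.orthogonal_orthogonal, h'] at hU0
        exact hU0 Submodule.top_orthogonal_eq_bot
    · exact LinearMap.ext fun v => Subsingleton.elim _ _

end Unitary

section Regular

variable {G : Type*} [Group G] [Fintype G]

/-- The regular representation on `L²(G)`. -/
def regularRep (G : Type*) [Group G] [Fintype G] :
    Representation ℂ G (EuclideanSpace ℂ G) where
  toFun g := (LinearIsometryEquiv.piLpCongrLeft 2 ℂ ℂ (Equiv.mulLeft g)).toLinearEquiv.toLinearMap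
  map_one' := by
    ext v x
    change v (1⁻¹ * x) = v x
    simp
  map_mul' g h := by
    ext v x
    change v ((g * h)⁻¹ * x) = v (h⁻¹ * (g⁻¹ * x))
    simp [mul_assoc]

theorem regularRep_apply (g x : G) (v : EuclideanSpace ℂ G) : regularRep G g v x = v (g⁻¹ * x) := by
  rfl

theorem regularRep_isIsometric : (regularRep G).IsIsometric := fun g v w =>
  (LinearIsometryEquiv.piLpCongrLeft 2 ℂ ℂ (Equiv.mulLeft g)).inner_map_map v w

/-- A class function orthogonal to all irreducible characters vanishes. -/
theorem eq_zero_of_forall_sum_mul_character_eq_zero {c : G → ℂ}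
    (hc : ∀ g h, c (h * g * h⁻¹) = c g)
    (horth : ∀ ρ : UnitaryIrrep G, ∑ g, c g * (unitaryRep ρ.hom).character g = 0) : c = 0 := by
  classical
  have h := Representation.IsIsometric.sum_smul_eq_zero hc horth _ _ _
    (regularRep_isIsometric (G := G)) rfl
  funext x
  -- Applied to the delta function at `1`, the zero operator has value `c x` at `x`.
  have h2 := congrArg
    (fun f : EuclideanSpace ℂ G →ₗ[ℂ] EuclideanSpace ℂ G => f (EuclideanSpace.single 1 1) x) h
  simpa [LinearMap.sum_apply, regularRep_apply, Pi.single_apply, inv_mul_eq_one] using h2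

end Regular

/-! ### The kernels of the trivial and of the nontrivial irreps. -/

namespace Irrep

variable {G : Type*} [Group G]

/-- The character of an irrep. -/
def char (ρ : Irrep G) : G → ℂ := (unitaryRep ρ.rep.hom).character

theorem char_eq_trace (ρ : Irrep G) (g : G) : ρ.char g = (ρ.mat g).trace :=
  Matrix.trace_toLin'_eq _

theorem char_one (ρ : Irrep G) : ρ.char 1 = ρ.dim := by
  rw [char, Representation.char_one, Module.finrank_fin_fun, dim]

theorem char_conj (ρ : Irrep G) (g h : G) : ρ.char (h * g * h⁻¹) = ρ.char g :=
  Representation.char_conj _ g h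

theorem char_inv_mul (ρ : Irrep G) (x y : G) :
    ρ.char (x⁻¹ * y) = ((ρ.mat x).conjTranspose * ρ.mat y).trace := by
  have : ρ.mat (x⁻¹ * y) = (ρ.mat x).conjTranspose * ρ.mat y := by
    rw [mat, map_mul, map_inv]
    rfl
  rw [char_eq_trace, this]

theorem char_mk (σ : UnitaryIrrep G) :
    char (Quotient.mk _ σ : Irrep G) = (unitaryRep σ.hom).character := by
  obtain ⟨e⟩ := Quotient.mk_out (s := UnitaryIrrep.setoid G) σ
  exact Representation.char_iso e

theorem IsTriv.char_eq {ρ : Irrep G} (hρ : ρ.IsTriv) (g : G) : ρ.char g = ρ.dim := by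
  rw [char_eq_trace, hρ, Matrix.trace_one, Fintype.card_fin]

variable [Fintype G]

open Classical in
theorem sum_char_mul_char_inv (ρ σ : Irrep G) :
    ∑ g, ρ.char g * σ.char g⁻¹ = if ρ = σ then (Fintype.card G : ℂ) else 0 := by
  have hG : (Nat.card G : ℂ) ≠ 0 := by simp
  have : Invertible (Nat.card G : ℂ) := invertibleOfNonzero hG
  have := fun τ : Irrep G => τ.rep.irreducible
  have h := Representation.char_orthonormal (unitaryRep ρ.rep.hom) (unitaryRep σ.rep.hom)
  have hiff : Nonempty ((unitaryRep σ.rep.hom).Equiv (unitaryRep ρ.rep.hom)) ↔ ρ = σ := by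
    constructor
    · intro h
      have h2 : Quotient.out σ ≈ Quotient.out ρ := h
      exact (Quotient.out_equiv_out.mp h2).symm
    · rintro rfl
      exact ⟨Representation.Equiv.refl _⟩
  rw [inv_mul_eq_iff_eq_mul₀ hG] at h
  simp only [hiff, mul_ite, mul_one, mul_zero, Nat.card_eq_fintype_card] at h
  exact h

open Classical in
/-- The decomposition of the character of the regular representation. -/
theorem sum_dim_mul_char (g : G) :
    ∑ ρ : Irrep G, (ρ.dim : ℂ) * ρ.char g = if g = 1 then (Fintype.card G : ℂ) else 0 := by
  -- The inverse in the argument puts the pairing with an irreducible character into the form of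
  -- `sum_char_mul_char_inv`; the two parts of `c` then both give the dimension and cancel.
  let c : G → ℂ := fun g =>
    (if g = 1 then (Fintype.card G : ℂ) else 0) - ∑ ρ : Irrep G, (ρ.dim : ℂ) * ρ.char g⁻¹
  have hc : c = 0 := by
    apply eq_zero_of_forall_sum_mul_character_eq_zero
    · intro g h
      have h1 : (h * g * h⁻¹)⁻¹ = h * g⁻¹ * h⁻¹ := by group
      simp only [c, h1, char_conj, conj_eq_one_iff]
    · intro σ
      rw [← char_mk]
      set j : Irrep G := Quotient.mk _ σ
      simp only [c, sub_mul, ite_mul, zero_mul, Finset.sum_sub_distrib, Finset.sum_ite_eq',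
        Finset.mem_univ, if_true, Finset.sum_mul]
      rw [Finset.sum_comm, char_one, Finset.sum_eq_single j]
      · have := sum_char_mul_char_inv j j
        rw [if_pos rfl] at this
        simp_rw [mul_assoc, ← Finset.mul_sum, mul_comm (j.char _⁻¹)]
        rw [this]
        ring
      · intro ρ _ hρ
        have := sum_char_mul_char_inv j ρ
        rw [if_neg hρ.symm] at this
        simp_rw [mul_assoc, ← Finset.mul_sum, mul_comm (ρ.char _⁻¹)]
        rw [this, mul_zero]
      · exact fun h => absurd (Finset.mem_univ _) h
  have h := congrFun hc g⁻¹
  simp only [c, inv_inv, inv_eq_one, Pi.zero_apply] at h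
  exact (sub_eq_zero.mp h).symm

/-- The average of the character is the dimension of the invariants. These form a subrepresentation,
which is zero unless everything is fixed. -/
theorem sum_char_eq_zero {ρ : Irrep G} (hρ : ¬ ρ.IsTriv) : ∑ g, ρ.char g = 0 := by
  have hG : (Nat.card G : ℂ) ≠ 0 := by simp
  have : Invertible (Nat.card G : ℂ) := invertibleOfNonzero hG
  have := ρ.rep.irreducible
  let R := unitaryRep ρ.rep.hom
  have h := Representation.card_inv_mul_sum_char_eq_finrank (k := ℂ) (ρ := R)
  let U : Subrepresentation R := ⟨R.invariants, fun g v hv => by rw [hv g]; exact hv⟩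
  rcases eq_bot_or_eq_top U with hU | hU
  · have hU' : R.invariants = ⊥ := congrArg Subrepresentation.toSubmodule hU
    rw [hU', finrank_bot, Nat.cast_zero, mul_eq_zero] at h
    exact h.resolve_left (inv_ne_zero hG)
  · have hU' : R.invariants = ⊤ := congrArg Subrepresentation.toSubmodule hU
    refine absurd (fun g => ?_) hρ
    have hR : R g = LinearMap.id := by
      refine LinearMap.ext fun v => ?_
      have : v ∈ R.invariants := hU' ▸ Submodule.mem_top
      exact this g
    have : Matrix.toLin' (ρ.mat g) = Matrix.toLin' 1 := by rw [Matrix.toLin'_one]; exact hR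
    exact Matrix.toLin'.injective this

open Classical in
-- Summing the regular character over the group kills the nontrivial irreps and multiplies the
-- trivial ones by `|G|`. This avoids proving that there is exactly one trivial class and that its
-- dimension is `1`.
theorem sum_isTriv_dim_mul_char (g : G) :
    ∑ ρ : Irrep G with ρ.IsTriv, (ρ.dim : ℂ) * ρ.char g = 1 := by
  have hG : (Fintype.card G : ℂ) ≠ 0 := by simp
  have h : ∑ h : G, ∑ ρ : Irrep G, (ρ.dim : ℂ) * ρ.char h = Fintype.card G := by
    simp_rw [sum_dim_mul_char]
    simp
  rw [Finset.sum_comm] at h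
  simp_rw [← Finset.mul_sum] at h
  rw [← Finset.sum_filter_add_sum_filter_not _ IsTriv,
    Finset.sum_eq_zero (s := Finset.univ.filter fun ρ : Irrep G => ¬ρ.IsTriv) fun ρ hρ => by
      rw [sum_char_eq_zero (Finset.mem_filter.mp hρ).2, mul_zero], add_zero] at h
  have h2 : ∀ ρ ∈ Finset.univ.filter (IsTriv (G := G)), (ρ.dim : ℂ) * ∑ g, ρ.char g =
      Fintype.card G * (ρ.dim * ρ.char g) := by
    intro ρ hρ
    have ht := (Finset.mem_filter.mp hρ).2
    simp_rw [ht.char_eq]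
    simp
    ring
  rw [Finset.sum_congr rfl h2, ← Finset.mul_sum] at h
  exact (mul_eq_left₀ hG).mp h

open Classical in
theorem sum_type_dim_mul_char (b : Bool) (x y : G) :
    ∑ ρ : Irrep G with decide (¬ρ.IsTriv) = b, (ρ.dim : ℂ) * ρ.char (x⁻¹ * y) =
      projKernel b x y := by
  cases b
  · simp only [decide_eq_false_iff_not, not_not, projKernel_false, Complex.ofReal_one]
    exact sum_isTriv_dim_mul_char _
  · have h := sum_dim_mul_char (x⁻¹ * y)
    rw [← Finset.sum_filter_add_sum_filter_not _ IsTriv, sum_isTriv_dim_mul_char] at h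
    simp only [decide_eq_true_eq, projKernel_true]
    rw [eq_sub_of_add_eq' h]
    simp only [inv_mul_eq_one]
    split_ifs <;> simp

end Irrep

/-! ### Identification of Fourier levels with pattern levels. -/

section LevelComponent

variable {G : Type*} [Group G] {n : ℕ}

theorem trace_tensorMat (ρ : Fin n → Irrep G) (x y : Fin n → G) :
    ((tensorMat ρ x).conjTranspose * tensorMat ρ y).trace =
      ∏ i, (ρ i).char ((x i)⁻¹ * y i) := by
  simp_rw [Irrep.char_inv_mul]
  simp only [Matrix.trace, Matrix.diag_apply, Matrix.mul_apply, Matrix.conjTranspose_apply,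
    tensorMat, Matrix.of_apply, star_prod, ← Finset.prod_mul_distrib]
  rw [Finset.prod_univ_sum, Fintype.piFinset_univ]
  refine Finset.sum_congr rfl fun a _ => ?_
  rw [Finset.prod_univ_sum, Fintype.piFinset_univ]

/-- The pattern of the coordinates at which a tensor product of irreps is nontrivial. -/
def irrepPattern (ρ : Fin n → Irrep G) (i : Fin n) : Bool :=
  open Classical in decide (¬(ρ i).IsTriv)

theorem patternLevel_irrepPattern (ρ : Fin n → Irrep G) :
    patternLevel (irrepPattern ρ) = irrepLevel ρ := by
  classical
  rw [patternLevel_eq_card, Fintype.card_subtype, irrepLevel]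
  simp [irrepPattern]

variable [Fintype G]

theorem sum_irrepPattern (B : Fin n → Bool) (x y : Fin n → G) :
    ∑ ρ with irrepPattern ρ = B, ∏ i, ((ρ i).dim : ℂ) * (ρ i).char ((x i)⁻¹ * y i) =
      prodKernel B x y := by
  classical
  have hset : (Finset.univ.filter fun ρ : Fin n → Irrep G => irrepPattern ρ = B) =
      Fintype.piFinset fun i => Finset.univ.filter fun r : Irrep G => decide (¬r.IsTriv) = B i := by
    ext ρ
    simp only [Finset.mem_filter, Finset.mem_univ, true_and, Fintype.mem_piFinset, funext_iff]
    rfl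
  rw [hset, ← Finset.prod_univ_sum (fun i => Finset.univ.filter fun r : Irrep G =>
    decide (¬r.IsTriv) = B i) fun i r => (r.dim : ℂ) * r.char ((x i)⁻¹ * y i), prodKernel]
  push_cast
  exact Finset.prod_congr rfl fun i _ => Irrep.sum_type_dim_mul_char _ _ _

/-- Each Fourier term is an average of `f` against a product of `d_ρ χ_ρ(x⁻¹y)` over the
coordinates. Grouping the irreps of `Gⁿ` by which factors are nontrivial makes these products add up
to `prodKernel B`. -/
theorem levelComponent_eq_levelSum (f : (Fin n → G) → ℂ) (k : ℕ) :
    levelComponent f k = fun x => levelSum (fun B => patternComponent f B x) k := by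
  classical
  funext x
  have h1 : ∀ ρ : Fin n → Irrep G, ((∏ i, (ρ i).dim : ℕ) : ℂ) *
      Matrix.trace ((tensorMat ρ x).conjTranspose * groupFourierCoeff f ρ) =
      𝔼 y, (∏ i, ((ρ i).dim : ℂ) * (ρ i).char ((x i)⁻¹ * y i)) * f y := by
    intro ρ
    let L : Matrix (∀ i, Fin (ρ i).dim) (∀ i, Fin (ρ i).dim) ℂ →ₗ[ℂ] ℂ :=
      (Matrix.traceLinearMap _ ℂ ℂ).comp
        (LinearMap.mulLeft ℂ (tensorMat ρ x).conjTranspose)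
    have : Matrix.trace ((tensorMat ρ x).conjTranspose * groupFourierCoeff f ρ) =
        L (groupFourierCoeff f ρ) := rfl
    rw [this, groupFourierCoeff, Finset.expect, map_nnrat_smul, map_sum, ← Finset.expect,
      Finset.mul_expect]
    refine Finset.expect_congr rfl fun y _ => ?_
    rw [map_smul, Finset.prod_mul_distrib, ← trace_tensorMat]
    push_cast
    change _ * (f y * ((tensorMat ρ x).conjTranspose * tensorMat ρ y).trace) = _
    ring
  rw [levelComponent, Finset.sum_congr rfl fun ρ _ => h1 ρ, ← Finset.expect_sum_comm]
  simp only [levelSum, patternComponent]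
  rw [← Finset.expect_sum_comm]
  refine Finset.expect_congr rfl fun y _ => ?_
  rw [← Finset.sum_mul, ← Finset.sum_mul]
  congr 1
  simp_rw [← sum_irrepPattern, ← patternLevel_irrepPattern]
  rw [← Finset.sum_fiberwise_of_maps_to (g := irrepPattern)
    (t := Finset.univ.filter fun B : Fin n → Bool => patternLevel B = k)
    (fun ρ hρ => by simpa using hρ)]
  refine Finset.sum_congr rfl fun B hB => Finset.sum_congr ?_ fun _ _ => rfl
  ext ρ
  simp only [Finset.mem_filter, Finset.mem_univ, true_and] at hB ⊢
  exact ⟨fun h => h.2, fun h => ⟨by rw [h, hB], h⟩⟩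

end LevelComponent

end

theorem theorem4p5 {V : Type*} [Fintype V] [Nonempty V] {d : ℕ} (hd : 0 < d)
    (X : RegularMultigraph V d) (lam : ℝ) (hlam : 0 ≤ lam) (hX : X.IsExpander lam) (n : ℕ) :
    (∀ (G : Type*) [Group G] [Fintype G] (φ : V → G), IsUnbiased φ →
      ∀ f : (Fin n → G) → ℂ, IsSymmetricFun f →
      ∀ τ : ℝ, τ = 16 * Real.exp 1 * lam * Fintype.card G →
        (lam < 1 / 2 → ∀ k : ℕ, 2 ≤ k →
          ‖X.walkError φ (levelComponent f k)‖ ≤ τ ^ ((k : ℝ) / 2) * normTwo f) ∧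
        (τ < 1 → ‖X.walkError φ f‖ ≤ 2 * τ * normTwo f)) ∧
    (∀ (S : Type*) [Fintype S] (φ : V → S), IsUnbiased φ →
      ∀ f : (Fin n → S) → ℂ, IsSymmetricFun f →
      ∀ τ : ℝ, τ = 16 * Real.exp 1 * lam * Fintype.card S →
        τ < 1 → ‖X.walkError φ f‖ ≤ 2 * τ * normTwo f) := by
  refine ⟨fun G _ _ φ hφ f hf τ hτ => ⟨fun hlam2 k hk => ?_, fun hτ1 => ?_⟩,
    fun S _ φ hφ f hf τ hτ hτ1 => ?_⟩
  · rw [levelComponent_eq_levelSum]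
    exact X.norm_walkError_levelSum_le_normTwo hd hlam hlam2.le hX hφ hf (by omega) hτ
  · exact X.norm_walkError_le hd hlam hX hφ hf hτ hτ1
  · have : Nonempty S := Nonempty.map φ inferInstance
    exact X.norm_walkError_le hd hlam hX hφ hf hτ hτ1
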